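/- Let $\mathcal{F}$ be the collection of functions $f:\mathbb{R}\to[0,\infty)$ that (i) are non-decreasing on $(-\infty,0]$ and strictly increasing on $[0,\infty)$; (ii) are differentiable on $(M,\infty)$ for some $M$; (iii) are such that, with $\varphi_f:=f'/f$, the function $\kappa\mapsto\kappa\varphi_f(\kappa)$ tends to $\infty$ as $\kappa\to\infty$ and is non-decreasing on $(M,\infty)$ for some $M$; and (iv) satisfy, for any $\xi,\zeta>-1$, $$\int_{-1}^1(1-s)^\xi(1+s)^\zeta\left|\frac{f(\kappa s)}{f(\kappa)}-e^{(s-1)\kappa\varphi_f(\kappa)}\right|ds=o\left(\frac{1}{(\kappa\varphi_f(\kappa))^{\xi+1}}\right)\quad\text{as }\kappa\to\infty.$$ Fix an integer $p\ge 2$, a unit vector $\theta\in\mathbb{R}^p$ and $f\in\mathcal{F}$, and let $(\kappa_n)$ be a sequence of positive reals that diverges to infinity. For each $n$, let $X_{n1},\dots,X_{nn}$ be independent random vectors on the unit sphere $\mathcal{S}^{p-1}$ of $\mathbb{R}^p$ with common density $$x\mapsto \frac{c_{p,\kappa_n,f}\,\Gamma(\frac{p-1}{2})}{2\pi^{(p-1)/2}}\,f(\kappa_n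 x'\theta),\qquad c_{p,\kappa,f}=1\Big/\int_{-1}^1(1-s^2)^{(p-3)/2}f(\kappa s)\,ds,$$ with respect to the surface area measure on $\mathcal{S}^{p-1}$. Let $\bar X_n=\frac1n\sum_{i=1}^nX_{ni}$, let $\hat\theta_n=\bar X_n/\|\bar X_n\|$ be the spherical mean, and let $\hat e_{n2}=\frac1n\sum_{i=1}^n(X_{ni}'\hat\theta_n)^2$. Then, as $n\to\infty$, $$\frac{\sqrt{n(p-1)}\,(\hat\theta_n-\theta)}{\sqrt{1-\hat e_{n2}}}\stackrel{\mathcal{D}}{\to}\mathcal{N}(0,I_p-\theta\theta'),$$ $$\frac{n(p-1)\big(1-(\theta'\hat\theta_n)^2\big)}{1-\hat e_{n2}}\stackrel{\mathcal{D}}{\to}\chi^2_{p-1}\qquad\text{and}\qquad\frac{2n(p-1)(1-\theta'\hat\theta_n)}{1-\hat e_{n2}}\stackrel{\mathcal{D}}{\to}\chi^2_{p-1}.$$ Moreover, for every $\alpha\in(0,1)$, the probability that $\theta$ belongs to the spherical cap $$\left\{t\in\mathcal{S}^{p-1}:\ t'\hat\theta_n\ge 1-\frac{1-\hat e_{n2}}{2n(p-1)}\,\chi^2_{p-1,1-\alpha}\right\},$$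 where $\chi^2_{p-1,1-\alpha}$ is the upper $\alpha$-quantile of the $\chi^2_{p-1}$ distribution, converges to $1-\alpha$. -/

import Mathlib

open MeasureTheory ProbabilityTheory Filter Topology Asymptotics
open scoped InnerProductSpace

noncomputable section

/-- The logarithmic derivative `φ_f = f' / f`. -/
def logDerivFun (f : ℝ → ℝ) (z : ℝ) : ℝ := deriv f z / f z

/-- The class `𝓕` of angular functions. In `approx`, the quotient `f (κ s) / f κ` is
`exp (log f (κ s) - log f κ)`, read with `exp (log 0) = 0` at the points where `f` vanishes;
note that `f κ > 0` for every `κ > 0` by `nonneg` and `strictMonoOn`. -/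
structure IsAngularFunction (f : ℝ → ℝ) : Prop where
  nonneg : ∀ z, 0 ≤ f z
  monotoneOn : MonotoneOn f (Set.Iic 0)
  strictMonoOn : StrictMonoOn f (Set.Ici 0)
  differentiableOn : ∃ M : ℝ, DifferentiableOn ℝ f (Set.Ioi M)
  tendsto_atTop : Tendsto (fun κ : ℝ => κ * logDerivFun f κ) atTop atTop
  eventually_monotone : ∃ M : ℝ, MonotoneOn (fun κ : ℝ => κ * logDerivFun f κ) (Set.Ioi M)
  approx : ∀ ξ ζ : ℝ, -1 < ξ → -1 < ζ →
    (fun κ : ℝ => ∫ s in (-1 : ℝ)..1, ((1 - s) ^ ξ * (1 + s) ^ ζ) *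
        |f (κ * s) / f κ - Real.exp ((s - 1) * (κ * logDerivFun f κ))|)
      =o[atTop] fun κ : ℝ => 1 / (κ * logDerivFun f κ) ^ (ξ + 1)

/-- The normalizing constant `c_{p,κ,f}`. -/
def rotConst (p : ℕ) (κ : ℝ) (f : ℝ → ℝ) : ℝ :=
  1 / ∫ s in (-1 : ℝ)..1, (1 - s ^ 2) ^ (((p : ℝ) - 3) / 2) * f (κ * s)

/-- The density of `Rot_p(θ, κ, f)` with respect to the surface area measure of the sphere. -/
def rotDensity {p : ℕ} (θ : EuclideanSpace ℝ (Fin p)) (κ : ℝ) (f : ℝ → ℝ)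
    (x : EuclideanSpace ℝ (Fin p)) : ℝ :=
  rotConst p κ f * Real.Gamma (((p : ℝ) - 1) / 2) / (2 * Real.pi ^ (((p : ℝ) - 1) / 2))
    * f (κ * ⟪x, θ⟫_ℝ)

/-- The rotationally symmetric distribution `Rot_p(θ, κ, f)`, as a measure on `ℝ^p` carried by the
unit sphere. -/
def rotLaw {p : ℕ} (θ : EuclideanSpace ℝ (Fin p)) (κ : ℝ) (f : ℝ → ℝ) :
    Measure (EuclideanSpace ℝ (Fin p)) :=
  (((volume : Measure (EuclideanSpace ℝ (Fin p))).toSphere).withDensity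
    (fun x => ENNReal.ofReal (rotDensity θ κ f x.1))).map Subtype.val

/-- The sample mean. -/
def sampleMean {n p : ℕ} (x : Fin n → EuclideanSpace ℝ (Fin p)) : EuclideanSpace ℝ (Fin p) :=
  (n : ℝ)⁻¹ • ∑ i, x i

/-- The spherical mean `θ̂_n`. -/
def sphericalMean {n p : ℕ} (x : Fin n → EuclideanSpace ℝ (Fin p)) :
    EuclideanSpace ℝ (Fin p) :=
  ‖sampleMean x‖⁻¹ • sampleMean x

/-- The estimator `ê_{n2}`. -/
def eHatTwo {n p : ℕ} (x : Fin n → EuclideanSpace ℝ (Fin p)) : ℝ :=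
  (n : ℝ)⁻¹ * ∑ i, ⟪x i, sphericalMean x⟫_ℝ ^ 2

/-- The chi-square distribution with `k` degrees of freedom. -/
def chiSquared (k : ℕ) : Measure ℝ :=
  (Measure.pi fun _ : Fin k => gaussianReal 0 1).map fun z => ∑ i, z i ^ 2

instance chiSquared_isProbabilityMeasure (k : ℕ) : IsProbabilityMeasure (chiSquared k) :=
  Measure.isProbabilityMeasure_map
    (show Measurable fun z : Fin k → ℝ => ∑ i, z i ^ 2 by fun_prop).aemeasurable

/-- The upper `α`-quantile of the chi-square distribution with `k` degrees of freedom. -/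
def chiSquaredUpperQuantile (k : ℕ) (α : ℝ) : ℝ :=
  sInf {x : ℝ | 1 - α ≤ cdf (chiSquared k) x}

/-- The feasible spherical cap confidence zone. -/
def feasibleCap {n p : ℕ} (α : ℝ) (x : Fin n → EuclideanSpace ℝ (Fin p)) :
    Set (EuclideanSpace ℝ (Fin p)) :=
  {θ | ‖θ‖ = 1 ∧
    1 - (1 - eHatTwo x) / (2 * n * ((p : ℝ) - 1)) * chiSquaredUpperQuantile (p - 1) α
      ≤ ⟪θ, sphericalMean x⟫_ℝ}

end

/-! Put `g n = κ n * logDerivFun f (κ n)`, which tends to infinity. Along `θ`, the law has density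
proportional to `(1 - s²)^((p-3)/2) f(κ s)` on `(-1, 1)`. Condition (iv) lets `f(κ s)/f(κ)` be
replaced by `exp((s-1) g)`, and Laplace's method (`tendsto_laplace_jacobi`, `tendsto_moment_ratio`)
shows that the first two moments of `g (1 - ⟪x, θ⟫)` converge to those of a Gamma variable of shape
`(p-1)/2`. These limits and the symmetry about `θ`, bundled in `IsConcentrating`, are all that is
used of `f` afterwards.

By symmetry the part of an observation orthogonal to `θ` is centred and isotropic in `θᗮ`, with
variance `E(1 - ⟪x, θ⟫²)/(p-1)`, asymptotically `1/g`, in each direction. A Lyapunov-type central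
limit theorem then makes `√(n g)` times the tangential part `T` of the sample mean asymptotically
standard Gaussian on `θᗮ` (`tendstoInDistribution_tangential`).

Moreover `⟪sampleMean, θ⟫` and `‖sampleMean‖` tend to 1, and `g (1 - eHatTwo)` tends to `p - 1` in
probability (`tendstoInMeasure_mul_one_sub_eHatTwo`), so the studentization supplies exactly the
unknown factor `√g`. Since `sphericalMean - θ` is `T / ‖sampleMean‖` plus a multiple of `θ`
quadratic in `T`, Slutsky's lemma gives asymptotic normality.

The two chi-square statistics are `‖z‖² - c ⟪z, θ⟫²` with `c = 1` and `c = 0`, where `z` is the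
studentized mean. The Gaussian limit is orthogonal to `θ`, so both have the same limit. Membership
of `θ` in the cap says that the second statistic does not exceed its asymptotic quantile.

The rows may live on different probability spaces. Only their laws matter, so they are realized
together on an infinite product, where convergence in probability makes sense. -/

/-! ### Polar coordinates and isometry invariance of the surface measure. -/

section Sphere

open Module

variable {E : Type*} [NormedAddCommGroup E] [InnerProductSpace ℝ E] [FiniteDimensional ℝ E]
  [MeasurableSpace E] [BorelSpace E]

/-- Integration in polar coordinates. -/
theorem lintegral_eq_lintegral_toSphere [Nontrivial E] (μ : Measure E) [μ.IsAddHaarMeasure]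
    {F : E → ENNReal} (hF : Measurable F) :
    ∫⁻ x, F x ∂μ = ∫⁻ y, (∫⁻ r in Set.Ioi (0 : ℝ),
      ENNReal.ofReal (r ^ (finrank ℝ E - 1)) * F (r • (y : E))) ∂μ.toSphere := by
  have h1 : ∫⁻ x, F x ∂μ = ∫⁻ x : ({(0)}ᶜ : Set E), F x ∂(μ.comap (↑)) := by
    rw [lintegral_subtype_comap (measurableSet_singleton _).compl F, restrict_compl_singleton]
  have hG : Measurable fun z : Metric.sphere (0 : E) 1 × Set.Ioi (0 : ℝ) =>
      F ((z.2 : ℝ) • (z.1 : E)) := by fun_prop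
  have h2 := μ.measurePreserving_homeomorphUnitSphereProd.lintegral_comp_emb
    (Homeomorph.measurableEmbedding _) fun z => F ((z.2 : ℝ) • (z.1 : E))
  rw [h1]
  have h3 : ∀ x : ({(0)}ᶜ : Set E), F (((homeomorphUnitSphereProd E x).2 : ℝ) •
      ((homeomorphUnitSphereProd E x).1 : E)) = F x := by
    intro x
    have hx : ‖(x : E)‖ ≠ 0 := norm_ne_zero_iff.2 x.2
    simp [smul_smul, hx]
  simp_rw [h3] at h2
  rw [h2, lintegral_prod _ hG.aemeasurable]
  refine lintegral_congr fun y => ?_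
  rw [Measure.volumeIoiPow, lintegral_withDensity_eq_lintegral_mul _ (by fun_prop) (by fun_prop)]
  exact lintegral_subtype_comap measurableSet_Ioi
    fun r => ENNReal.ofReal (r ^ (finrank ℝ E - 1)) * F (r • (y : E))

theorem lintegral_Ioi_indicator_pow_ne (m : ℕ) :
    ∫⁻ r in Set.Ioi (0 : ℝ), ENNReal.ofReal (r ^ m) * (Set.Iio (1 : ℝ)).indicator 1 r
      = ENNReal.ofReal (1 / (m + 1)) := by
  have h := Measure.volumeIoiPow_apply_Iio m ⟨1, Set.mem_Ioi.2 one_pos⟩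
  rw [← lintegral_indicator_one measurableSet_Iio, Measure.volumeIoiPow,
    lintegral_withDensity_eq_lintegral_mul _ (by fun_prop)
      (measurable_one.indicator measurableSet_Iio)] at h
  have h' := lintegral_subtype_comap (μ := volume) (measurableSet_Ioi (a := (0 : ℝ)))
    fun r => ENNReal.ofReal (r ^ m) * (Set.Iio (1 : ℝ)).indicator 1 r
  rw [← h']
  simp only [one_pow] at h
  rw [← h]
  rfl

/-- Spherical integrals as integrals over the punctured unit ball. -/
theorem lintegral_toSphere_eq [Nontrivial E] (μ : Measure E) [μ.IsAddHaarMeasure]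
    {G : E → ENNReal} (hG : Measurable G) :
    ∫⁻ x, (Set.Iio (1 : ℝ)).indicator 1 ‖x‖ * G (‖x‖⁻¹ • x) ∂μ
      = ENNReal.ofReal (1 / (finrank ℝ E : ℝ)) * ∫⁻ y, G y ∂μ.toSphere := by
  have hm : Measurable fun x : E => (Set.Iio (1 : ℝ)).indicator (1 : ℝ → ENNReal) ‖x‖ :=
    (measurable_one.indicator measurableSet_Iio).comp measurable_norm
  have hd : ((finrank ℝ E - 1 : ℕ) : ℝ) + 1 = finrank ℝ E := by
    rw [Nat.cast_pred finrank_pos]; ring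
  rw [lintegral_eq_lintegral_toSphere μ (by fun_prop), ← lintegral_const_mul _ (by fun_prop)]
  refine lintegral_congr fun y => ?_
  rw [← hd, ← lintegral_Ioi_indicator_pow_ne, ← lintegral_mul_const _ (f := fun r : ℝ =>
    ENNReal.ofReal (r ^ (finrank ℝ E - 1)) * (Set.Iio (1 : ℝ)).indicator 1 r)
    (Measurable.mul (by fun_prop) (measurable_one.indicator measurableSet_Iio))]
  refine setLIntegral_congr_fun measurableSet_Ioi fun r hr => ?_
  have hr : 0 < r := hr
  simp [norm_smul, abs_of_pos hr, smul_smul, hr.ne', mul_assoc]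

/-- Invariance is inherited from Lebesgue measure: both sides are integrals over the unit ball of a
function of the direction, up to the nonzero factor `1 / finrank`, which cancels. -/
theorem lintegral_toSphere_comp_isometry [Nontrivial E] (A : E ≃ₗᵢ[ℝ] E)
    {G : E → ENNReal} (hG : Measurable G) :
    ∫⁻ y, G (A y) ∂(volume : Measure E).toSphere = ∫⁻ y, G y ∂(volume : Measure E).toSphere := by
  have h1 := lintegral_toSphere_eq (volume : Measure E) hG
  have h2 := lintegral_toSphere_eq (volume : Measure E) (hG.comp A.continuous.measurable)
  have h3 := A.measurePreserving.lintegral_comp_emb A.toHomeomorph.measurableEmbedding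
    fun x => (Set.Iio (1 : ℝ)).indicator 1 ‖x‖ * G (‖x‖⁻¹ • x)
  simp only [LinearIsometryEquiv.norm_map, ← map_smul] at h3
  simp only [Function.comp_apply] at h2
  rw [h3, h1] at h2
  refine ((ENNReal.mul_right_inj ?_ ENNReal.ofReal_ne_top).1 h2).symm
  have : (0 : ℝ) < finrank ℝ E := by exact_mod_cast finrank_pos
  simpa [← Nat.pos_iff_ne_zero] using this

end Sphere

/-! ### The marginal of the surface measure along an axis. -/

section SphereMarginal

open Module Set

variable {E : Type*} [NormedAddCommGroup E] [InnerProductSpace ℝ E] [FiniteDimensional ℝ E]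
  [MeasurableSpace E] [BorelSpace E]

/-- The splitting of a point into its component along a unit vector and its orthogonal part. -/
noncomputable def axisEquiv (θ : E) (hθ : ‖θ‖ = 1) : (ℝ × (ℝ ∙ θ)ᗮ) ≃ₗ[ℝ] E where
  toFun z := z.1 • θ + (z.2 : E)
  invFun x := (⟪x, θ⟫_ℝ, ⟨x - ⟪x, θ⟫_ℝ • θ, by
    rw [Submodule.mem_orthogonal_singleton_iff_inner_left, inner_sub_left, real_inner_smul_left,
      real_inner_self_eq_norm_sq, hθ]; ring⟩)
  map_add' z w := by simp only [Prod.fst_add, Prod.snd_add, Submodule.coe_add]; module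
  map_smul' c z := by simp [smul_smul]
  left_inv z := by
    have h := (Submodule.mem_orthogonal_singleton_iff_inner_left).1 z.2.2
    have h1 : ⟪z.1 • θ + (z.2 : E), θ⟫_ℝ = z.1 := by
      rw [inner_add_left, real_inner_smul_left, real_inner_self_eq_norm_sq, hθ, h]; ring
    ext <;> simp [h1]
  right_inv x := by simp

/-- Uniqueness of Haar measure up to a scalar. The scalar is left unidentified because only ratios
of integrals are used later. -/
theorem exists_lintegral_eq_axis (θ : E) (hθ : ‖θ‖ = 1) :
    ∃ c : ENNReal, ∀ F : E → ENNReal, Measurable F →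
      ∫⁻ x, F x = c * ∫⁻ a : ℝ, ∫⁻ w : (ℝ ∙ θ)ᗮ, F (a • θ + (w : E)) := by
  let L := (axisEquiv θ hθ).toContinuousLinearEquiv
  have hL : ∀ z : ℝ × (ℝ ∙ θ)ᗮ, L z = z.1 • θ + (z.2 : E) := fun z => rfl
  let ν : Measure E := ((volume : Measure ℝ).prod (volume : Measure (ℝ ∙ θ)ᗮ)).map L
  have : ν.IsAddHaarMeasure := L.isAddHaarMeasure_map _
  refine ⟨(volume : Measure E).addHaarScalarFactor ν, fun F hF => ?_⟩
  conv_lhs => rw [Measure.isAddLeftInvariant_eq_smul (volume : Measure E) ν]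
  rw [lintegral_smul_measure, lintegral_map hF L.continuous.measurable,
    lintegral_prod _ (by fun_prop)]
  rfl

/-- Substitution `s = cos φ`; one factor `sin φ` is absorbed by the Jacobian, whence the exponent `m
- 1`. -/
theorem lintegral_sin_pow_mul_comp_cos (m : ℕ) (h : ℝ → ENNReal) :
    ∫⁻ φ in Ioo 0 Real.pi, ENNReal.ofReal (Real.sin φ ^ m) * h (Real.cos φ)
      = ∫⁻ s in Ioo (-1 : ℝ) 1, ENNReal.ofReal ((1 - s ^ 2) ^ (((m : ℝ) - 1) / 2)) * h s := by
  have himg : Real.cos '' Ioo 0 Real.pi = Ioo (-1) 1 := by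
    ext s
    constructor
    · rintro ⟨φ, hφ, rfl⟩
      have h0 := Real.sin_pos_of_pos_of_lt_pi hφ.1 hφ.2
      have h1 := Real.sin_sq_add_cos_sq φ
      constructor <;> nlinarith
    · intro hs
      refine ⟨Real.arccos s, ⟨?_, ?_⟩, Real.cos_arccos hs.1.le hs.2.le⟩
      · exact Real.arccos_pos.2 hs.2
      · refine lt_of_le_of_ne (Real.arccos_le_pi s) fun h => ?_
        exact absurd (Real.arccos_eq_pi.1 h) (not_le.2 hs.1)
  rw [← himg, lintegral_image_eq_lintegral_abs_deriv_mul measurableSet_Ioo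
    (fun x _ => (Real.hasDerivAt_cos x).hasDerivWithinAt)
    (Real.injOn_cos.mono Ioo_subset_Icc_self)]
  refine setLIntegral_congr_fun measurableSet_Ioo fun φ hφ => ?_
  have h0 := Real.sin_pos_of_pos_of_lt_pi hφ.1 hφ.2
  have h1 : 1 - Real.cos φ ^ 2 = Real.sin φ ^ 2 := by rw [Real.sin_sq]
  rw [← mul_assoc, ← ENNReal.ofReal_mul (abs_nonneg _), abs_neg, abs_of_pos h0, h1]
  congr 2
  rw [← Real.rpow_natCast (Real.sin φ) 2, ← Real.rpow_mul h0.le]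
  nth_rewrite 2 [← Real.rpow_one (Real.sin φ)]
  rw [← Real.rpow_add h0, ← Real.rpow_natCast]
  congr 1
  push_cast
  ring

/-- Here `a` is the coordinate along the axis and `r` the distance to it. In planar polar
coordinates the integrand factors; the radial part is `∫₀¹ ρ^(m+1) dρ`, the extra power coming from
the Jacobian. -/
theorem lintegral_lintegral_halfplane_polar (m : ℕ) {h : ℝ → ENNReal} (hh : Measurable h) :
    ∫⁻ a : ℝ, ∫⁻ r in Ioi (0 : ℝ), ENNReal.ofReal (r ^ m) *
        ((Iio (1 : ℝ)).indicator 1 √(a ^ 2 + r ^ 2) * h ((√(a ^ 2 + r ^ 2))⁻¹ * a))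
      = ENNReal.ofReal (1 / ((m + 1 : ℕ) + 1)) *
        ∫⁻ φ in Ioo 0 Real.pi, ENNReal.ofReal (Real.sin φ ^ m) * h (Real.cos φ) := by
  have hi : Measurable ((Iio (1 : ℝ)).indicator (1 : ℝ → ENNReal)) :=
    measurable_one.indicator measurableSet_Iio
  have hi0 : Measurable ((Ioi (0 : ℝ)).indicator (1 : ℝ → ENNReal)) :=
    measurable_one.indicator measurableSet_Ioi
  let Φ : ℝ × ℝ → ENNReal := fun z => (Ioi (0 : ℝ)).indicator 1 z.2 *
    (ENNReal.ofReal (z.2 ^ m) * ((Iio (1 : ℝ)).indicator 1 √(z.1 ^ 2 + z.2 ^ 2) *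
      h ((√(z.1 ^ 2 + z.2 ^ 2))⁻¹ * z.1)))
  have hΦ : Measurable Φ := by fun_prop
  have h1 : ∫⁻ a : ℝ, ∫⁻ r in Ioi (0 : ℝ), ENNReal.ofReal (r ^ m) *
        ((Iio (1 : ℝ)).indicator 1 √(a ^ 2 + r ^ 2) * h ((√(a ^ 2 + r ^ 2))⁻¹ * a))
      = ∫⁻ z, Φ z := by
    rw [Measure.volume_eq_prod, lintegral_prod _ hΦ.aemeasurable]
    refine lintegral_congr fun a => ?_
    rw [← lintegral_indicator measurableSet_Ioi]
    refine lintegral_congr fun r => ?_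
    by_cases hr : r ∈ Ioi (0 : ℝ) <;> simp [Φ, hr]
  rw [h1, ← lintegral_comp_polarCoord_symm, polarCoord_target, Measure.volume_eq_prod,
    ← Measure.prod_restrict, ← lintegral_Ioi_indicator_pow_ne]
  -- The polar angle ranges over `(-π, π)`; the constraint `r > 0` becomes `sin φ > 0` and cuts it
  -- down to `(0, π)`.
  have h2 : ∫⁻ φ in Ioo 0 Real.pi, ENNReal.ofReal (Real.sin φ ^ m) * h (Real.cos φ)
      = ∫⁻ φ in Ioo (-Real.pi) Real.pi, (Ioi (0 : ℝ)).indicator 1 (Real.sin φ) *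
        (ENNReal.ofReal (Real.sin φ ^ m) * h (Real.cos φ)) := by
    rw [← lintegral_indicator measurableSet_Ioo, ← lintegral_indicator measurableSet_Ioo]
    refine lintegral_congr fun φ => ?_
    by_cases h0 : φ ∈ Ioo (-Real.pi) Real.pi
    · by_cases h3 : 0 < φ
      · have h4 := Real.sin_pos_of_pos_of_lt_pi h3 h0.2
        have h5 : φ ∈ Ioo 0 Real.pi := ⟨h3, h0.2⟩
        simp [h0, h5, h4]
      · have h4 := Real.sin_nonpos_of_nonpos_of_neg_pi_le (not_lt.1 h3) h0.1.le
        have h5 : φ ∉ Ioo 0 Real.pi := fun h => h3 h.1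
        rw [indicator_of_notMem h5, indicator_of_mem h0, indicator_of_notMem
          (show Real.sin φ ∉ Ioi (0 : ℝ) from not_lt.2 h4), zero_mul]
    · have h5 : φ ∉ Ioo 0 Real.pi := fun h => h0 ⟨by linarith [h.1, Real.pi_pos], h.2⟩
      simp [h0, h5]
  rw [h2, ← lintegral_prod_mul (by fun_prop) (by fun_prop)]
  rw [Measure.prod_restrict]
  refine setLIntegral_congr_fun (measurableSet_Ioi.prod measurableSet_Ioo) fun z hz => ?_
  have hz1 : 0 < z.1 := hz.1
  have hs : √((z.1 * Real.cos z.2) ^ 2 + (z.1 * Real.sin z.2) ^ 2) = z.1 := by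
    rw [show (z.1 * Real.cos z.2) ^ 2 + (z.1 * Real.sin z.2) ^ 2
      = z.1 ^ 2 * (Real.sin z.2 ^ 2 + Real.cos z.2 ^ 2) by ring, Real.sin_sq_add_cos_sq, mul_one,
      Real.sqrt_sq hz1.le]
  simp only [polarCoord_symm_apply, Φ, hs, smul_eq_mul]
  have hc : z.1⁻¹ * (z.1 * Real.cos z.2) = Real.cos z.2 := by field_simp
  have hp : ENNReal.ofReal (z.1 ^ (m + 1)) = ENNReal.ofReal z.1 * ENNReal.ofReal (z.1 ^ m) := by
    rw [← ENNReal.ofReal_mul hz1.le]; congr 1; ring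
  rw [hc, mul_pow, ENNReal.ofReal_mul (by positivity), hp]
  by_cases h4 : 0 < Real.sin z.2
  · have h5 : z.1 * Real.sin z.2 ∈ Ioi (0 : ℝ) := mul_pos hz1 h4
    rw [indicator_of_mem h5, indicator_of_mem (show Real.sin z.2 ∈ Ioi (0 : ℝ) from h4)]
    simp only [Pi.one_apply]
    ring
  · have h5 : z.1 * Real.sin z.2 ∉ Ioi (0 : ℝ) :=
      not_lt.2 (mul_nonpos_of_nonneg_of_nonpos hz1.le (not_lt.1 h4))
    rw [indicator_of_notMem h5, indicator_of_notMem (show Real.sin z.2 ∉ Ioi (0 : ℝ) from h4)]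
    simp

/-- The marginal of the surface measure along an axis has density proportional to
`(1 - s²) ^ ((d - 3) / 2)`. -/
theorem exists_lintegral_toSphere_inner (θ : E) (hθ : ‖θ‖ = 1) (hd : 2 ≤ finrank ℝ E) :
    ∃ C : ENNReal, ∀ h : ℝ → ENNReal, Measurable h →
      ∫⁻ y : Metric.sphere (0 : E) 1, h ⟪(y : E), θ⟫_ℝ ∂(volume : Measure E).toSphere
        = C * ∫⁻ s in Ioo (-1 : ℝ) 1,
          ENNReal.ofReal ((1 - s ^ 2) ^ (((finrank ℝ E : ℝ) - 3) / 2)) * h s := by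
  have : Nontrivial E := nontrivial_of_finrank_pos (R := ℝ) (by omega)
  have hθ0 : θ ≠ 0 := fun h => by simp [h] at hθ
  -- With this shift `θᗮ` has dimension `m + 1` and radial density `r ^ m`; for `m = 0` its unit
  -- sphere is a pair of points.
  obtain ⟨m, hm⟩ : ∃ m, finrank ℝ E = m + 2 := ⟨finrank ℝ E - 2, by omega⟩
  have hK : finrank ℝ (ℝ ∙ θ)ᗮ = m + 1 := by
    have h1 := (ℝ ∙ θ).finrank_add_finrank_orthogonal
    rw [finrank_span_singleton hθ0] at h1
    omega
  have : Nontrivial (ℝ ∙ θ)ᗮ := nontrivial_of_finrank_pos (R := ℝ) (by omega)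
  obtain ⟨c, hc⟩ := exists_lintegral_eq_axis θ hθ
  have hi : Measurable ((Iio (1 : ℝ)).indicator (1 : ℝ → ENNReal)) :=
    measurable_one.indicator measurableSet_Iio
  have hd0 : ENNReal.ofReal (1 / (finrank ℝ E : ℝ)) ≠ 0 := by
    rw [hm, Ne, ENNReal.ofReal_eq_zero, not_le]; positivity
  -- The factors are: the inverse of the radial constant of the unit ball, the Haar scalar, the
  -- total surface measure of the sphere of `θᗮ`, and the half-plane radial integral.
  refine ⟨(ENNReal.ofReal (1 / (finrank ℝ E : ℝ)))⁻¹ * (c *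
    ((volume : Measure (ℝ ∙ θ)ᗮ).toSphere univ * ENNReal.ofReal (1 / ((m + 1 : ℕ) + 1)))),
    fun h hh => ?_⟩
  have h1 := lintegral_toSphere_eq (volume : Measure E) (G := fun x => h ⟪x, θ⟫_ℝ) (by fun_prop)
  have h2 : ∀ a : ℝ, ∫⁻ w : (ℝ ∙ θ)ᗮ, (Iio (1 : ℝ)).indicator 1 ‖a • θ + (w : E)‖ *
      h ⟪‖a • θ + (w : E)‖⁻¹ • (a • θ + (w : E)), θ⟫_ℝ
      = (volume : Measure (ℝ ∙ θ)ᗮ).toSphere univ * ∫⁻ r in Ioi (0 : ℝ), ENNReal.ofReal (r ^ m) *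
        ((Iio (1 : ℝ)).indicator 1 √(a ^ 2 + r ^ 2) * h ((√(a ^ 2 + r ^ 2))⁻¹ * a)) := by
    intro a
    rw [lintegral_eq_lintegral_toSphere volume (by fun_prop), mul_comm, ← lintegral_const]
    refine lintegral_congr fun y => ?_
    refine setLIntegral_congr_fun measurableSet_Ioi fun r hr => ?_
    have hr : 0 < r := hr
    have h0 := (Submodule.mem_orthogonal_singleton_iff_inner_left).1 (y : (ℝ ∙ θ)ᗮ).2
    have hy : ‖((y : (ℝ ∙ θ)ᗮ) : E)‖ = 1 := norm_eq_of_mem_sphere y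
    have hn : ‖a • θ + ((r • (y : (ℝ ∙ θ)ᗮ) : (ℝ ∙ θ)ᗮ) : E)‖ = √(a ^ 2 + r ^ 2) := by
      rw [eq_comm, Real.sqrt_eq_iff_mul_self_eq (by positivity) (norm_nonneg _), ← pow_two,
        norm_add_sq_real, Submodule.coe_smul, real_inner_smul_left, real_inner_smul_right,
        real_inner_comm, h0, norm_smul, norm_smul, hθ, hy]
      simp
    have hin : ⟪a • θ + ((r • (y : (ℝ ∙ θ)ᗮ) : (ℝ ∙ θ)ᗮ) : E), θ⟫_ℝ = a := by
      rw [inner_add_left, Submodule.coe_smul, real_inner_smul_left, real_inner_smul_left, h0,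
        real_inner_self_eq_norm_sq, hθ]
      ring
    simp only [hn, real_inner_smul_left, hin, hK, Nat.add_sub_cancel]
  have hd' : ((finrank ℝ E : ℝ) - 3) / 2 = ((m : ℝ) - 1) / 2 := by
    rw [hm]; push_cast; ring
  rw [hc _ (by fun_prop), lintegral_congr h2, lintegral_const_mul _ (by fun_prop),
    lintegral_lintegral_halfplane_polar m hh, lintegral_sin_pow_mul_comp_cos] at h1
  rw [hd', mul_assoc, mul_assoc, mul_assoc, h1, ← mul_assoc,
    ENNReal.inv_mul_cancel hd0 ENNReal.ofReal_ne_top, one_mul]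

end SphereMarginal

/-! ### First and second moments under symmetry about an axis. -/

section AxialSymmetry

open Module

variable {E : Type*} [NormedAddCommGroup E] [InnerProductSpace ℝ E]

theorem norm_sub_inner_smul_sq {θ : E} (hθ : ‖θ‖ = 1) (x : E) :
    ‖x - ⟪x, θ⟫_ℝ • θ‖ ^ 2 = ‖x‖ ^ 2 - ⟪x, θ⟫_ℝ ^ 2 := by
  rw [norm_sub_sq_real, real_inner_smul_right, norm_smul, hθ, Real.norm_eq_abs, mul_one, sq_abs]
  ring

theorem inner_sub_inner_smul_right {θ : E} (hθ : ‖θ‖ = 1) (x : E) :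
    ⟪x - ⟪x, θ⟫_ℝ • θ, θ⟫_ℝ = 0 := by
  rw [inner_sub_left, real_inner_smul_left, real_inner_self_eq_norm_sq, hθ]
  ring

theorem inner_sub_inner_smul_comm (θ x t : E) :
    ⟪x - ⟪x, θ⟫_ℝ • θ, t⟫_ℝ = ⟪t - ⟪t, θ⟫_ℝ • θ, x⟫_ℝ := by
  rw [inner_sub_left, inner_sub_left, real_inner_smul_left, real_inner_smul_left,
    real_inner_comm x t, real_inner_comm x θ, real_inner_comm t θ]
  ring

theorem sum_sq_inner_orthogonal_singleton [FiniteDimensional ℝ E] {ι : Type*} [Fintype ι]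
    {θ : E} (hθ : ‖θ‖ = 1) (b : OrthonormalBasis ι ℝ (ℝ ∙ θ)ᗮ) (x : E) :
    ∑ i, ⟪(b i : E), x⟫_ℝ ^ 2 = ‖x‖ ^ 2 - ⟪x, θ⟫_ℝ ^ 2 := by
  let k : (ℝ ∙ θ)ᗮ := ⟨x - ⟪x, θ⟫_ℝ • θ,
    (Submodule.mem_orthogonal_singleton_iff_inner_left).2 (inner_sub_inner_smul_right hθ x)⟩
  rw [← norm_sub_inner_smul_sq hθ]
  change _ = ‖k‖ ^ 2
  rw [← b.sum_sq_inner_right k]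
  refine Finset.sum_congr rfl fun i _ => ?_
  have h0 := (Submodule.mem_orthogonal_singleton_iff_inner_left).1 (b i).2
  rw [Submodule.coe_inner]
  simp [k, inner_sub_right, real_inner_smul_right, h0]

variable [MeasurableSpace E] [BorelSpace E]

/-- A probability measure on the unit sphere that is invariant under the isometries fixing `θ`. -/
structure IsAxialLaw (θ : E) (μ : Measure E) : Prop where
  isProbabilityMeasure : IsProbabilityMeasure μ
  norm_eq_one : ∀ᵐ x ∂μ, ‖x‖ = 1
  map_isometry : ∀ A : E ≃ₗᵢ[ℝ] E, A θ = θ → μ.map A = μ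

namespace IsAxialLaw

variable {θ : E} {μ : Measure E}

theorem integral_comp_isometry (hμ : IsAxialLaw θ μ) (A : E ≃ₗᵢ[ℝ] E) (hA : A θ = θ) (F : E → ℝ) :
    ∫ x, F (A x) ∂μ = ∫ x, F x ∂μ := by
  conv_rhs => rw [← hμ.map_isometry A hA]
  exact (A.toHomeomorph.measurableEmbedding.integral_map F).symm

/-- The reflection in the hyperplane orthogonal to `t` fixes `θ` and changes the sign of the
integrand. -/
theorem integral_inner_eq_zero [FiniteDimensional ℝ E] (hμ : IsAxialLaw θ μ) {t : E}
    (ht : ⟪t, θ⟫_ℝ = 0) : ∫ x, ⟪t, x⟫_ℝ ∂μ = 0 := by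
  have h1 := hμ.integral_comp_isometry (ℝ ∙ t)ᗮ.reflection
    (Submodule.reflection_mem_subspace_eq_self
      ((Submodule.mem_orthogonal_singleton_iff_inner_right).2 ht)) fun x => ⟪t, x⟫_ℝ
  have h2 : ∀ x, ⟪t, (ℝ ∙ t)ᗮ.reflection x⟫_ℝ = -⟪t, x⟫_ℝ := by
    intro x
    rw [← LinearIsometryEquiv.inner_map_map (ℝ ∙ t)ᗮ.reflection t
      ((ℝ ∙ t)ᗮ.reflection x), Submodule.reflection_reflection,
      Submodule.reflection_orthogonalComplement_singleton_eq_neg, inner_neg_left]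
  simp_rw [h2, integral_neg] at h1
  linarith

/-- The reflection exchanging `s` and `t` fixes `θ`, since `s - t` is orthogonal to it. -/
theorem integral_inner_sq_eq_of_norm_eq [FiniteDimensional ℝ E] (hμ : IsAxialLaw θ μ) {s t : E}
    (hs : ⟪s, θ⟫_ℝ = 0) (ht : ⟪t, θ⟫_ℝ = 0) (hst : ‖s‖ = ‖t‖) :
    ∫ x, ⟪s, x⟫_ℝ ^ 2 ∂μ = ∫ x, ⟪t, x⟫_ℝ ^ 2 ∂μ := by
  have h0 : ⟪s - t, θ⟫_ℝ = 0 := by rw [inner_sub_left, hs, ht, sub_zero]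
  have h1 := hμ.integral_comp_isometry (ℝ ∙ (s - t))ᗮ.reflection
    (Submodule.reflection_mem_subspace_eq_self
      ((Submodule.mem_orthogonal_singleton_iff_inner_right).2 h0)) fun x => ⟪t, x⟫_ℝ ^ 2
  have h2 : ∀ x, ⟪t, (ℝ ∙ (s - t))ᗮ.reflection x⟫_ℝ = ⟪s, x⟫_ℝ := by
    intro x
    rw [← LinearIsometryEquiv.inner_map_map (ℝ ∙ (s - t))ᗮ.reflection s x,
      Submodule.reflection_sub hst]
  simp_rw [h2] at h1
  exact h1

omit [BorelSpace E] in
theorem integrable_of_bound (hμ : IsAxialLaw θ μ) {F : E → ℝ} (hF : Measurable F) {C : ℝ}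
    (hC : ∀ x, ‖x‖ = 1 → |F x| ≤ C) : Integrable F μ := by
  have := hμ.isProbabilityMeasure
  refine Integrable.of_bound hF.aestronglyMeasurable C ?_
  filter_upwards [hμ.norm_eq_one] with x hx using hC x hx

/-- By Parseval the second moments along an orthonormal basis of `θᗮ` add up to `∫ (1 - ⟪x, θ⟫²)`,
and by symmetry they are all equal. -/
theorem integral_inner_sq [FiniteDimensional ℝ E] (hμ : IsAxialLaw θ μ) (hθ : ‖θ‖ = 1)
    (hd : 2 ≤ finrank ℝ E) {t : E} (ht : ⟪t, θ⟫_ℝ = 0) :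
    ∫ x, ⟪t, x⟫_ℝ ^ 2 ∂μ
      = ‖t‖ ^ 2 * (∫ x, (1 - ⟪x, θ⟫_ℝ ^ 2) ∂μ) / ((finrank ℝ E : ℝ) - 1) := by
  have hθ0 : θ ≠ 0 := fun h => by simp [h] at hθ
  have hK : (finrank ℝ (ℝ ∙ θ)ᗮ : ℝ) = (finrank ℝ E : ℝ) - 1 := by
    have h1 := (ℝ ∙ θ).finrank_add_finrank_orthogonal
    rw [finrank_span_singleton hθ0] at h1
    rw [← h1]; push_cast; ring
  have hd' : (2 : ℝ) ≤ finrank ℝ E := by exact_mod_cast hd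
  by_cases ht0 : t = 0
  · simp [ht0]
  have htn : ‖t‖ ≠ 0 := norm_ne_zero_iff.2 ht0
  let b := stdOrthonormalBasis ℝ (ℝ ∙ θ)ᗮ
  have hb0 : ∀ i, ⟪(b i : E), θ⟫_ℝ = 0 := fun i =>
    (Submodule.mem_orthogonal_singleton_iff_inner_left).1 (b i).2
  have hbn : ∀ i, ‖(b i : E)‖ = 1 := fun i => b.norm_eq_one i
  have h1 : ∀ i, ∫ x, ⟪(b i : E), x⟫_ℝ ^ 2 ∂μ = (‖t‖ ^ 2)⁻¹ * ∫ x, ⟪t, x⟫_ℝ ^ 2 ∂μ := by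
    intro i
    rw [hμ.integral_inner_sq_eq_of_norm_eq (hb0 i) (t := ‖t‖⁻¹ • t)
      (by rw [real_inner_smul_left, ht, mul_zero])
      (by rw [norm_smul, norm_inv, norm_norm, inv_mul_cancel₀ htn, hbn]), ← integral_const_mul]
    refine integral_congr_ae (Eventually.of_forall fun x => ?_)
    simp only [real_inner_smul_left]
    ring
  have h2 : ∫ x, (1 - ⟪x, θ⟫_ℝ ^ 2) ∂μ = ∑ i, ∫ x, ⟪(b i : E), x⟫_ℝ ^ 2 ∂μ := by
    rw [← integral_finsetSum]
    · refine integral_congr_ae ?_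
      filter_upwards [hμ.norm_eq_one] with x hx
      rw [sum_sq_inner_orthogonal_singleton hθ, hx, one_pow]
    · intro i _
      refine hμ.integrable_of_bound (by fun_prop) (C := 1) fun x hx => ?_
      have := abs_real_inner_le_norm (b i : E) x
      rw [hbn, hx, mul_one] at this
      rw [abs_pow]
      exact pow_le_one₀ (abs_nonneg _) this
  simp_rw [h2, h1, Finset.sum_const, Finset.card_univ, Fintype.card_fin, nsmul_eq_mul, hK]
  have : (finrank ℝ E : ℝ) - 1 ≠ 0 := by linarith
  field_simp

end IsAxialLaw

end AxialSymmetry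

/-! ### Symmetry and axial moments of the rotationally symmetric law. -/

section RotLaw

open Set

theorem IsAngularFunction.monotone {f : ℝ → ℝ} (hf : IsAngularFunction f) : Monotone f :=
  hf.monotoneOn.Iic_union_Ici hf.strictMonoOn.monotoneOn

variable {p : ℕ} {θ : EuclideanSpace ℝ (Fin p)} {κ : ℝ} {f : ℝ → ℝ}

theorem measurable_rotDensity (hf : Measurable f) : Measurable (rotDensity θ κ f) := by
  unfold rotDensity
  fun_prop

theorem lintegral_rotLaw (hf : Measurable f) {G : EuclideanSpace ℝ (Fin p) → ENNReal}
    (hG : Measurable G) :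
    ∫⁻ x, G x ∂(rotLaw θ κ f) = ∫⁻ y, ENNReal.ofReal (rotDensity θ κ f (y : _)) * G y
      ∂(volume : Measure (EuclideanSpace ℝ (Fin p))).toSphere := by
  have := measurable_rotDensity (θ := θ) (κ := κ) hf
  rw [rotLaw, lintegral_map hG measurable_subtype_coe,
    lintegral_withDensity_eq_lintegral_mul _ (by fun_prop) (by fun_prop)]
  rfl

/-- The density depends on `⟪x, θ⟫` only and the surface measure is isometry invariant. Total mass
one is a hypothesis, so the normalizing constant need not be checked; it will follow from the
existence of a random vector with this law. -/
theorem rotLaw_isAxialLaw (hp : 2 ≤ p) (hf : Measurable f)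
    (h : IsProbabilityMeasure (rotLaw θ κ f)) : IsAxialLaw θ (rotLaw θ κ f) where
  isProbabilityMeasure := h
  norm_eq_one := by
    rw [rotLaw, ae_map_iff measurable_subtype_coe.aemeasurable
      (measurableSet_eq_fun (by fun_prop) (by fun_prop))]
    exact Eventually.of_forall fun y => norm_eq_of_mem_sphere y
  map_isometry A hA := by
    have : Nontrivial (EuclideanSpace ℝ (Fin p)) :=
      Module.nontrivial_of_finrank_pos (R := ℝ) (by simp; omega)
    have hA' : ∀ x, rotDensity θ κ f (A x) = rotDensity θ κ f x := by
      intro x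
      have : ⟪A x, θ⟫_ℝ = ⟪x, θ⟫_ℝ := by
        conv_lhs => rw [← hA]
        exact A.inner_map_map x θ
      simp only [rotDensity, this]
    have hd := measurable_rotDensity (θ := θ) (κ := κ) hf
    refine Measure.ext_of_lintegral _ fun G hG => ?_
    rw [lintegral_map hG A.continuous.measurable, lintegral_rotLaw hf
      (show Measurable fun x => G (A x) by fun_prop), lintegral_rotLaw hf hG, ← lintegral_toSphere_comp_isometry A
      (G := fun x => ENNReal.ofReal (rotDensity θ κ f x) * G x) (by fun_prop)]
    simp only [hA']

/-- Moments of the axial component as ratios of one-dimensional integrals. -/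
theorem integral_rotLaw (hp : 2 ≤ p) (hθ : ‖θ‖ = 1) (hf : Measurable f) (hf0 : ∀ z, 0 ≤ f z)
    (hprob : IsProbabilityMeasure (rotLaw θ κ f)) {h : ℝ → ℝ} (hh : Measurable h)
    (h0 : ∀ s ∈ Icc (-1 : ℝ) 1, 0 ≤ h s) :
    ∫ x, h ⟪x, θ⟫_ℝ ∂(rotLaw θ κ f)
      = (∫ s in Ioo (-1 : ℝ) 1, (1 - s ^ 2) ^ (((p : ℝ) - 3) / 2) * f (κ * s) * h s) /
        ∫ s in Ioo (-1 : ℝ) 1, (1 - s ^ 2) ^ (((p : ℝ) - 3) / 2) * f (κ * s) := by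
  obtain ⟨C, hC⟩ := exists_lintegral_toSphere_inner θ hθ (by simpa using hp)
  have hax := rotLaw_isAxialLaw hp hf hprob
  let K : ℝ := rotConst p κ f * Real.Gamma (((p : ℝ) - 1) / 2) / (2 * Real.pi ^ (((p : ℝ) - 1) / 2))
  have hw : ∀ s ∈ Ioo (-1 : ℝ) 1, 0 ≤ (1 - s ^ 2) ^ (((p : ℝ) - 3) / 2) * f (κ * s) :=
    fun s hs => mul_nonneg (Real.rpow_nonneg (by nlinarith [hs.1, hs.2]) _) (hf0 _)
  have key : ∀ k : ℝ → ℝ, Measurable k → (∀ s ∈ Icc (-1 : ℝ) 1, 0 ≤ k s) →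
      ∫⁻ x, ENNReal.ofReal (k ⟪x, θ⟫_ℝ) ∂(rotLaw θ κ f) = (C * ENNReal.ofReal K) *
        ∫⁻ s in Ioo (-1 : ℝ) 1,
          ENNReal.ofReal ((1 - s ^ 2) ^ (((p : ℝ) - 3) / 2) * f (κ * s) * k s) := by
    intro k hk hk0
    rw [lintegral_rotLaw hf (by fun_prop)]
    have h1 := hC (fun s => ENNReal.ofReal (K * f (κ * s)) * ENNReal.ofReal (k s)) (by fun_prop)
    simp only [finrank_euclideanSpace, Fintype.card_fin] at h1
    change ∫⁻ y : Metric.sphere (0 : EuclideanSpace ℝ (Fin p)) 1,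
      ENNReal.ofReal (K * f (κ * ⟪(y : EuclideanSpace ℝ (Fin p)), θ⟫_ℝ)) *
      ENNReal.ofReal (k ⟪(y : EuclideanSpace ℝ (Fin p)), θ⟫_ℝ) ∂_ = _
    rw [h1, mul_assoc]
    congr 1
    rw [← lintegral_const_mul _ (by fun_prop)]
    refine setLIntegral_congr_fun measurableSet_Ioo fun s hs => ?_
    have hs0 : 0 ≤ 1 - s ^ 2 := by nlinarith [hs.1, hs.2]
    rw [ENNReal.ofReal_mul' (hf0 _), ENNReal.ofReal_mul (hw s hs),
      ENNReal.ofReal_mul (Real.rpow_nonneg hs0 _)]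
    ring
  have hnn : ∀ k : ℝ → ℝ, (∀ s ∈ Icc (-1 : ℝ) 1, 0 ≤ k s) →
      0 ≤ᵐ[rotLaw θ κ f] fun x => k ⟪x, θ⟫_ℝ := by
    intro k hk
    filter_upwards [hax.norm_eq_one] with x hx
    have := abs_real_inner_le_norm x θ
    rw [hx, hθ, mul_one] at this
    exact hk _ (abs_le.1 this)
  have hI : ∀ k : ℝ → ℝ, Measurable k → (∀ s ∈ Icc (-1 : ℝ) 1, 0 ≤ k s) →
      ∫ x, k ⟪x, θ⟫_ℝ ∂(rotLaw θ κ f) = (C * ENNReal.ofReal K).toReal *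
        ∫ s in Ioo (-1 : ℝ) 1, (1 - s ^ 2) ^ (((p : ℝ) - 3) / 2) * f (κ * s) * k s := by
    intro k hk hk0
    rw [integral_eq_lintegral_of_nonneg_ae (hnn k hk0)
      (Measurable.aestronglyMeasurable (by fun_prop)), key k hk hk0,
      integral_eq_lintegral_of_nonneg_ae _
      (Measurable.aestronglyMeasurable (by fun_prop)), ENNReal.toReal_mul]
    filter_upwards [ae_restrict_mem measurableSet_Ioo] with s hs
    exact mul_nonneg (hw s hs) (hk0 s ⟨hs.1.le, hs.2.le⟩)
  -- Total mass one identifies the unknown constant as the inverse of the denominator.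
  have h1 := hI (fun _ => 1) measurable_const fun _ _ => zero_le_one
  simp only [integral_const, probReal_univ, smul_eq_mul, mul_one] at h1
  rw [hI h hh h0]
  have h2 : (∫ s in Ioo (-1 : ℝ) 1, (1 - s ^ 2) ^ (((p : ℝ) - 3) / 2) * f (κ * s)) ≠ 0 :=
    fun h => by rw [h, mul_zero] at h1; exact one_ne_zero h1
  rw [eq_div_iff h2, mul_assoc, mul_comm (∫ s in Ioo (-1 : ℝ) 1, _ * _ * _), ← mul_assoc, ← h1,
    one_mul]

end RotLaw

/-! ### Laplace asymptotics for Jacobi weights. -/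

section Laplace

open Set

theorem intervalIntegrable_jacobi_weight {ξ ζ : ℝ} (hξ : -1 < ξ) (hζ : -1 < ζ) :
    IntervalIntegrable (fun s : ℝ => (1 - s) ^ ξ * (1 + s) ^ ζ) volume (-1) 1 := by
  have h1 : IntervalIntegrable (fun s : ℝ => (1 - s) ^ ξ * (1 + s) ^ ζ) volume (-1) 0 := by
    have h0 : IntervalIntegrable (fun s : ℝ => (1 + s) ^ ζ) volume (-1) 0 := by
      have := (intervalIntegral.intervalIntegrable_rpow' (a := 0) (b := 1) hζ).comp_add_left 1
      simpa using this
    refine h0.continuousOn_mul ?_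
    rw [uIcc_of_le (by norm_num)]
    exact ContinuousOn.rpow_const (by fun_prop) fun s hs => Or.inl (by linarith [hs.2])
  have h2 : IntervalIntegrable (fun s : ℝ => (1 - s) ^ ξ * (1 + s) ^ ζ) volume 0 1 := by
    have h0 : IntervalIntegrable (fun s : ℝ => (1 - s) ^ ξ) volume 0 1 := by
      have := (intervalIntegral.intervalIntegrable_rpow' (a := 0) (b := 1) hξ).comp_sub_left 1
      simpa using this.symm
    refine h0.mul_continuousOn ?_
    rw [uIcc_of_le (by norm_num)]
    exact ContinuousOn.rpow_const (by fun_prop) fun s hs => Or.inl (by linarith [hs.1])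
  exact h1.trans h2

/-- After the substitution `s = 1 - t/g` this is a truncated Gamma integral with an additional
factor `(2 - t/g)^ζ`, which tends to `2^ζ`; dominated convergence applies. -/
theorem tendsto_laplace_right_half {ξ : ℝ} (hξ : -1 < ξ) (ζ : ℝ) :
    Tendsto (fun g : ℝ => g ^ (ξ + 1) *
      ∫ s in (0 : ℝ)..1, (1 - s) ^ ξ * (1 + s) ^ ζ * Real.exp ((s - 1) * g)) atTop
      (𝓝 (2 ^ ζ * Real.Gamma (ξ + 1))) := by
  have hlim : Tendsto (fun g : ℝ => ∫ t in Ioi (0 : ℝ), (Iic g).indicator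
      (fun t => t ^ ξ * (2 - t / g) ^ ζ * Real.exp (-t)) t) atTop
      (𝓝 (∫ t in Ioi (0 : ℝ), 2 ^ ζ * (Real.exp (-t) * t ^ (ξ + 1 - 1)))) := by
    refine tendsto_integral_filter_of_dominated_convergence
      (fun t => 2 ^ |ζ| * (Real.exp (-t) * t ^ (ξ + 1 - 1))) ?_ ?_ ?_ ?_
    · refine Eventually.of_forall fun g => Measurable.aestronglyMeasurable ?_
      exact Measurable.indicator (by fun_prop) measurableSet_Iic
    · filter_upwards [eventually_gt_atTop 0] with g hg
      filter_upwards [ae_restrict_mem measurableSet_Ioi] with t ht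
      have ht : 0 < t := ht
      have hb : 0 ≤ 2 ^ |ζ| * (Real.exp (-t) * t ^ (ξ + 1 - 1)) := by positivity
      by_cases htg : t ∈ Iic g
      · rw [indicator_of_mem htg]
        have h1 : t / g ≤ 1 := (div_le_one hg).2 htg
        have h0 : 0 < t / g := by positivity
        -- On the right half the base lies in `[1, 2]`, so the bound holds whatever the sign of `ζ`.
        have h2 : (2 - t / g) ^ ζ ≤ 2 ^ |ζ| :=
          (Real.rpow_le_rpow_of_exponent_le (by linarith) (le_abs_self ζ)).trans
            (Real.rpow_le_rpow (by linarith) (by linarith) (abs_nonneg ζ))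
        have h3 : 0 ≤ (2 - t / g) ^ ζ := Real.rpow_nonneg (by linarith) _
        rw [Real.norm_of_nonneg (by positivity), add_sub_cancel_right]
        calc t ^ ξ * (2 - t / g) ^ ζ * Real.exp (-t) ≤ t ^ ξ * 2 ^ |ζ| * Real.exp (-t) := by
              gcongr
          _ = _ := by ring
      · rw [indicator_of_notMem htg, norm_zero]
        exact hb
    · exact (Real.GammaIntegral_convergent (by linarith : 0 < ξ + 1)).const_mul _
    · filter_upwards [ae_restrict_mem measurableSet_Ioi] with t ht
      have h1 : Tendsto (fun g : ℝ => 2 - t / g) atTop (𝓝 (2 - 0)) :=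
        tendsto_const_nhds.sub (tendsto_const_nhds.div_atTop tendsto_id)
      have h2 : Tendsto (fun g : ℝ => t ^ ξ * (2 - t / g) ^ ζ * Real.exp (-t)) atTop
          (𝓝 (t ^ ξ * (2 - 0) ^ ζ * Real.exp (-t))) :=
        (tendsto_const_nhds.mul (h1.rpow_const (Or.inl (by norm_num)))).mul tendsto_const_nhds
      rw [show t ^ ξ * (2 - 0) ^ ζ * Real.exp (-t) = 2 ^ ζ * (Real.exp (-t) * t ^ (ξ + 1 - 1)) by
        rw [add_sub_cancel_right, sub_zero]; ring] at h2
      refine h2.congr' ?_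
      filter_upwards [eventually_ge_atTop t] with g hg
      rw [indicator_of_mem (show t ∈ Iic g from hg)]
  rw [integral_const_mul, ← Real.Gamma_eq_integral (by linarith)] at hlim
  refine hlim.congr' ?_
  filter_upwards [eventually_gt_atTop 0] with g hg
  have h1 := intervalIntegral.integral_comp_sub_mul (a := 0) (b := g)
    (fun s : ℝ => (1 - s) ^ ξ * (1 + s) ^ ζ * Real.exp ((s - 1) * g)) (inv_ne_zero hg.ne') 1
  rw [inv_inv, mul_zero, sub_zero, inv_mul_cancel₀ hg.ne', sub_self, smul_eq_mul] at h1
  rw [Real.rpow_add hg, Real.rpow_one, mul_assoc, ← h1, ← intervalIntegral.integral_const_mul,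
    intervalIntegral.integral_of_le hg.le, setIntegral_indicator measurableSet_Iic, Ioi_inter_Iic]
  refine setIntegral_congr_fun measurableSet_Ioc fun t ht => ?_
  have ht0 : 0 < t := ht.1
  have e1 : (1 - (1 - g⁻¹ * t)) = t / g := by field_simp; ring
  have e2 : (1 + (1 - g⁻¹ * t)) = 2 - t / g := by field_simp; ring
  have e3 : (1 - g⁻¹ * t - 1) * g = -t := by field_simp; ring
  simp only [e1, e2, e3]
  rw [Real.div_rpow ht0.le hg.le]
  have : g ^ ξ ≠ 0 := (Real.rpow_pos_of_pos hg _).ne'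
  field_simp

/-- For `s ≤ 0` the exponential is at most `exp(-g)`, which beats the power of `g`. -/
theorem tendsto_laplace_left_half {ξ ζ : ℝ} (hξ : -1 < ξ) (hζ : -1 < ζ) :
    Tendsto (fun g : ℝ => g ^ (ξ + 1) *
      ∫ s in (-1 : ℝ)..0, (1 - s) ^ ξ * (1 + s) ^ ζ * Real.exp ((s - 1) * g)) atTop (𝓝 0) := by
  have hW : IntervalIntegrable (fun s : ℝ => (1 - s) ^ ξ * (1 + s) ^ ζ) volume (-1) 0 :=
    (intervalIntegrable_jacobi_weight hξ hζ).mono_set (by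
      rw [uIcc_of_le (by norm_num), uIcc_of_le (by norm_num)]
      exact Icc_subset_Icc le_rfl zero_le_one)
  have h1 := (tendsto_rpow_mul_exp_neg_mul_atTop_nhds_zero (ξ + 1) 1 one_pos).mul_const
    (∫ s in (-1 : ℝ)..0, (1 - s) ^ ξ * (1 + s) ^ ζ)
  rw [zero_mul] at h1
  have hnn : ∀ s ∈ Icc (-1 : ℝ) 0, 0 ≤ (1 - s) ^ ξ * (1 + s) ^ ζ := fun s hs =>
    mul_nonneg (Real.rpow_nonneg (by linarith [hs.2]) _) (Real.rpow_nonneg (by linarith [hs.1]) _)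
  refine squeeze_zero' ?_ ?_ h1
  · filter_upwards [eventually_gt_atTop 0] with g hg
    refine mul_nonneg (by positivity) (intervalIntegral.integral_nonneg (by norm_num) fun s hs => ?_)
    exact mul_nonneg (hnn s hs) (Real.exp_nonneg _)
  · filter_upwards [eventually_gt_atTop 0] with g hg
    rw [mul_assoc]
    refine mul_le_mul_of_nonneg_left ?_ (by positivity)
    rw [← intervalIntegral.integral_const_mul]
    refine intervalIntegral.integral_mono_on (by norm_num) (hW.mul_continuousOn (by fun_prop))
      (hW.const_mul _) fun s hs => ?_
    rw [mul_comm]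
    refine mul_le_mul_of_nonneg_right (Real.exp_le_exp.2 ?_) (hnn s hs)
    nlinarith [hs.2]

theorem tendsto_laplace_jacobi {ξ ζ : ℝ} (hξ : -1 < ξ) (hζ : -1 < ζ) :
    Tendsto (fun g : ℝ => g ^ (ξ + 1) *
      ∫ s in (-1 : ℝ)..1, (1 - s) ^ ξ * (1 + s) ^ ζ * Real.exp ((s - 1) * g)) atTop
      (𝓝 (2 ^ ζ * Real.Gamma (ξ + 1))) := by
  have h := (tendsto_laplace_left_half hξ hζ).add (tendsto_laplace_right_half hξ ζ)
  rw [zero_add] at h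
  refine h.congr fun g => ?_
  have hW := (intervalIntegrable_jacobi_weight hξ hζ).mul_continuousOn
    (g := fun s => Real.exp ((s - 1) * g)) (by fun_prop)
  rw [← mul_add, intervalIntegral.integral_add_adjacent_intervals]
  · exact hW.mono_set (by
      rw [uIcc_of_le (by norm_num), uIcc_of_le (by norm_num)]
      exact Icc_subset_Icc le_rfl zero_le_one)
  · exact hW.mono_set (by
      rw [uIcc_of_le (by norm_num), uIcc_of_le (by norm_num)]
      exact Icc_subset_Icc (by norm_num) le_rfl)

end Laplace

/-! ### Moment asymptotics for angular functions. -/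

namespace IsAngularFunction

open Set

variable {f : ℝ → ℝ}

theorem pos (hf : IsAngularFunction f) {κ : ℝ} (hκ : 0 < κ) : 0 < f κ :=
  (hf.nonneg 0).trans_lt (hf.strictMonoOn (mem_Ici.2 le_rfl) hκ.le hκ)

theorem intervalIntegrable_weight_mul (hf : IsAngularFunction f) {ξ ζ : ℝ} (hξ : -1 < ξ)
    (hζ : -1 < ζ) {κ : ℝ} (hκ : 0 < κ) :
    IntervalIntegrable (fun s : ℝ => (1 - s) ^ ξ * (1 + s) ^ ζ * (f (κ * s) / f κ))
      volume (-1) 1 := by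
  have hm := hf.monotone.measurable
  have h := intervalIntegrable_jacobi_weight hξ hζ
  rw [intervalIntegrable_iff_integrableOn_Ioc_of_le (by norm_num)] at h ⊢
  refine Integrable.mul_bdd (c := 1) h (Measurable.aestronglyMeasurable (by fun_prop)) ?_
  filter_upwards [ae_restrict_mem measurableSet_Ioc] with s hs
  have h0 := hf.pos hκ
  rw [Real.norm_of_nonneg (div_nonneg (hf.nonneg _) h0.le), div_le_one h0]
  exact hf.monotone (by nlinarith [hs.2])

/-- By `approx`, replacing the quotient by the exponential costs an error negligible at the scale of
the Laplace limit. -/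
theorem tendsto_rpow_mul_integral (hf : IsAngularFunction f) {ξ ζ : ℝ} (hξ : -1 < ξ)
    (hζ : -1 < ζ) :
    Tendsto (fun κ : ℝ => (κ * logDerivFun f κ) ^ (ξ + 1) *
      ∫ s in (-1 : ℝ)..1, (1 - s) ^ ξ * (1 + s) ^ ζ * (f (κ * s) / f κ)) atTop
      (𝓝 (2 ^ ζ * Real.Gamma (ξ + 1))) := by
  have hm := hf.monotone.measurable
  have h1 := (tendsto_laplace_jacobi hξ hζ).comp hf.tendsto_atTop
  have h2 := (hf.approx ξ ζ hξ hζ).tendsto_div_nhds_zero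
  have h3 : Tendsto (fun κ : ℝ => (κ * logDerivFun f κ) ^ (ξ + 1) *
      (∫ s in (-1 : ℝ)..1, (1 - s) ^ ξ * (1 + s) ^ ζ * (f (κ * s) / f κ)) -
      (κ * logDerivFun f κ) ^ (ξ + 1) * ∫ s in (-1 : ℝ)..1, (1 - s) ^ ξ * (1 + s) ^ ζ *
        Real.exp ((s - 1) * (κ * logDerivFun f κ))) atTop (𝓝 0) := by
    refine squeeze_zero_norm' ?_ h2
    filter_upwards [eventually_gt_atTop 0, hf.tendsto_atTop.eventually_gt_atTop 0] with κ hκ hg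
    have hW := intervalIntegrable_jacobi_weight hξ hζ
    have i1 := hf.intervalIntegrable_weight_mul hξ hζ hκ
    have i2 := hW.mul_continuousOn
      (g := fun s => Real.exp ((s - 1) * (κ * logDerivFun f κ))) (by fun_prop)
    rw [← mul_sub, ← intervalIntegral.integral_sub i1 i2, norm_mul,
      Real.norm_of_nonneg (by positivity), div_eq_mul_inv _ (1 / _), one_div, inv_inv, mul_comm]
    refine mul_le_mul_of_nonneg_right ?_ (by positivity)
    refine (intervalIntegral.norm_integral_le_integral_norm (by norm_num)).trans (le_of_eq ?_)
    refine intervalIntegral.integral_congr fun s hs => ?_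
    rw [uIcc_of_le (by norm_num)] at hs
    have hnn : 0 ≤ (1 - s) ^ ξ * (1 + s) ^ ζ :=
      mul_nonneg (Real.rpow_nonneg (by linarith [hs.2]) _)
        (Real.rpow_nonneg (by linarith [hs.1]) _)
    rw [← mul_sub, norm_mul, Real.norm_of_nonneg hnn, Real.norm_eq_abs]
  have h4 := h3.add h1
  rw [zero_add] at h4
  refine h4.congr fun κ => ?_
  simp only [Function.comp_apply]
  ring

/-- Writing `1 - s² = (1-s)(1+s)`, the numerator has exponents `(a + k, a)` and the denominator `(a,
a)`; the factors `2^a`, `f κ` and `g^(a+1)` cancel. The limits are the moments of a Gamma variable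
of shape `a + 1`. -/
theorem tendsto_moment_ratio (hf : IsAngularFunction f) {a : ℝ} (ha : -1 < a) (k : ℕ) :
    Tendsto (fun κ : ℝ => (κ * logDerivFun f κ) ^ k *
      ((∫ s in Ioo (-1 : ℝ) 1, (1 - s ^ 2) ^ a * f (κ * s) * (1 - s) ^ k) /
        ∫ s in Ioo (-1 : ℝ) 1, (1 - s ^ 2) ^ a * f (κ * s))) atTop
      (𝓝 (Real.Gamma (a + k + 1) / Real.Gamma (a + 1))) := by
  have hΓ : Real.Gamma (a + 1) ≠ 0 := (Real.Gamma_pos_of_pos (by linarith)).ne'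
  have h2 : (2 : ℝ) ^ a ≠ 0 := by positivity
  have hk : (0 : ℝ) ≤ k := Nat.cast_nonneg k
  have hlim := (hf.tendsto_rpow_mul_integral (ξ := a + k) (ζ := a) (by linarith) ha).div
    (hf.tendsto_rpow_mul_integral (ξ := a) (ζ := a) ha ha) (by positivity)
  rw [mul_div_mul_left _ _ h2] at hlim
  refine hlim.congr' ?_
  filter_upwards [eventually_gt_atTop 0, hf.tendsto_atTop.eventually_gt_atTop 0] with κ hκ hg
  have hI : ∀ j : ℕ, (∫ s in Ioo (-1 : ℝ) 1, (1 - s ^ 2) ^ a * f (κ * s) * (1 - s) ^ j)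
      = f κ * ∫ s in (-1 : ℝ)..1, (1 - s) ^ (a + j) * (1 + s) ^ a * (f (κ * s) / f κ) := by
    intro j
    rw [intervalIntegral.integral_of_le (by norm_num), integral_Ioc_eq_integral_Ioo,
      ← integral_const_mul]
    refine setIntegral_congr_fun measurableSet_Ioo fun s hs => ?_
    have e1 : 0 < 1 - s := by linarith [hs.2]
    have e2 : 0 < 1 + s := by linarith [hs.1]
    have hfκ := (hf.pos hκ).ne'
    rw [show 1 - s ^ 2 = (1 - s) * (1 + s) by ring, Real.mul_rpow e1.le e2.le, Real.rpow_add e1,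
      Real.rpow_natCast]
    field_simp
  have hI0 := hI 0
  simp only [pow_zero, mul_one, Nat.cast_zero, add_zero] at hI0
  have hfκ := (hf.pos hκ).ne'
  simp only [Pi.div_apply]
  rw [hI k, hI0, mul_div_mul_left _ _ hfκ, show a + k + 1 = k + (a + 1) by ring,
    Real.rpow_add hg k (a + 1), Real.rpow_natCast, mul_assoc, mul_div_assoc, mul_div_mul_left]
  positivity

end IsAngularFunction

/-! ### Convergence in probability to a constant. -/

section ConvergenceInMeasure

variable {Ω ι F G : Type*} {mΩ : MeasurableSpace Ω} {P : Measure Ω} {l : Filter ι}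
  [PseudoMetricSpace F] [PseudoMetricSpace G]

theorem tendstoInMeasure_const_iff {Y : ι → Ω → F} {c : F} :
    TendstoInMeasure P Y l (fun _ => c) ↔
      ∀ U ∈ 𝓝 c, Tendsto (fun i => P {ω | Y i ω ∉ U}) l (𝓝 0) := by
  rw [tendstoInMeasure_iff_dist]
  constructor
  · intro h U hU
    obtain ⟨ε, hε, hεU⟩ := Metric.mem_nhds_iff.1 hU
    refine tendsto_of_tendsto_of_tendsto_of_le_of_le tendsto_const_nhds (h ε hε)
      (fun _ => zero_le) fun i => measure_mono fun ω hω => ?_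
    exact not_lt.1 fun hlt => hω (hεU (Metric.mem_ball.2 hlt))
  · intro h ε hε
    refine tendsto_of_tendsto_of_tendsto_of_le_of_le tendsto_const_nhds
      (h _ (Metric.ball_mem_nhds c hε)) (fun _ => zero_le) fun i => measure_mono fun ω hω => ?_
    exact fun hb => not_lt.2 (show ε ≤ dist (Y i ω) c from hω) (Metric.mem_ball.1 hb)

/-- A common form of the continuous mapping theorem and of arguments on events of probability
tending to one; `Z` need only be controlled where `Y` is near `c`, and no measurability is required.
-/
theorem tendstoInMeasure_const_of_imp {Y : ι → Ω → F} {Z : ι → Ω → G} {c : F} {d : G}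
    (hY : TendstoInMeasure P Y l (fun _ => c))
    (h : ∀ V ∈ 𝓝 d, ∃ U ∈ 𝓝 c, ∀ᶠ i in l, ∀ᵐ ω ∂P, Y i ω ∈ U → Z i ω ∈ V) :
    TendstoInMeasure P Z l (fun _ => d) := by
  rw [tendstoInMeasure_const_iff] at hY ⊢
  intro V hV
  obtain ⟨U, hU, hUV⟩ := h V hV
  refine tendsto_of_tendsto_of_tendsto_of_le_of_le' tendsto_const_nhds (hY U hU)
    (Eventually.of_forall fun _ => zero_le) ?_
  filter_upwards [hUV] with i hi
  refine measure_mono_ae ?_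
  filter_upwards [hi] with ω hω hZ hY
  exact hZ (hω hY)

theorem MeasureTheory.TendstoInMeasure.comp_continuousAt {Y : ι → Ω → F} {c : F}
    (hY : TendstoInMeasure P Y l (fun _ => c)) {φ : F → G} (hφ : ContinuousAt φ c) :
    TendstoInMeasure P (fun i ω => φ (Y i ω)) l (fun _ => φ c) :=
  tendstoInMeasure_const_of_imp hY fun V hV =>
    ⟨φ ⁻¹' V, hφ hV, Eventually.of_forall fun _ => Eventually.of_forall fun _ h => h⟩

theorem MeasureTheory.TendstoInMeasure.prodMk_const {Y : ι → Ω → F} {Z : ι → Ω → G} {c : F} {d : G}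
    (hY : TendstoInMeasure P Y l (fun _ => c)) (hZ : TendstoInMeasure P Z l (fun _ => d)) :
    TendstoInMeasure P (fun i ω => (Y i ω, Z i ω)) l (fun _ => (c, d)) := by
  rw [tendstoInMeasure_const_iff] at hY hZ ⊢
  intro W hW
  obtain ⟨U, hU, V, hV, hUV⟩ := mem_nhds_prod_iff.1 hW
  have h := (hY U hU).add (hZ V hV)
  rw [add_zero] at h
  refine tendsto_of_tendsto_of_tendsto_of_le_of_le tendsto_const_nhds h
    (fun _ => zero_le) fun i => (measure_mono fun ω hω => ?_).trans (measure_union_le _ _)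
  by_contra hn
  simp only [Set.mem_union, Set.mem_ofPred_eq, not_or, not_not] at hn
  exact hω (hUV ⟨hn.1, hn.2⟩)

theorem tendstoInMeasure_const_of_tendsto {c : ι → F} {d : F} (h : Tendsto c l (𝓝 d)) :
    TendstoInMeasure P (fun i _ => c i) l (fun _ => d) := by
  rw [tendstoInMeasure_const_iff]
  intro U hU
  refine tendsto_const_nhds.congr' ?_
  filter_upwards [h hU] with i hi
  simp [show c i ∈ U from hi]

/-- Convergence in distribution to a constant implies convergence in probability. -/
theorem MeasureTheory.TendstoInDistribution.tendstoInMeasure_const [MeasurableSpace F] [BorelSpace F]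
    [IsProbabilityMeasure P] {Ω' : Type*} {mΩ' : MeasurableSpace Ω'} {P' : Measure Ω'}
    [IsProbabilityMeasure P'] {Y : ι → Ω → F} {c : F}
    (h : TendstoInDistribution Y l (fun _ : Ω' => c) (fun _ => P) P') :
    TendstoInMeasure P Y l (fun _ => c) := by
  rw [tendstoInMeasure_iff_dist]
  intro ε hε
  -- Portmanteau for this closed set, which is null for the Dirac mass at `c`.
  have hcl : IsClosed {x : F | ε ≤ dist x c} := isClosed_le continuous_const (by fun_prop)
  have h1 := ProbabilityMeasure.limsup_measure_closed_le_of_tendsto h.tendsto hcl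
  simp only [ProbabilityMeasure.coe_mk] at h1
  rw [Measure.map_const, measure_univ, one_smul, Measure.dirac_apply' _ hcl.measurableSet,
    Set.indicator_of_notMem (by simpa using hε)] at h1
  have h2 : ∀ i, P {ω | ε ≤ dist (Y i ω) c} = P.map (Y i) {x : F | ε ≤ dist x c} := fun i => by
    rw [Measure.map_apply_of_aemeasurable (h.forall_aemeasurable i) hcl.measurableSet]
    rfl
  simp_rw [h2]
  exact tendsto_of_le_liminf_of_limsup_le zero_le h1

end ConvergenceInMeasure

/-! ### Limit theorems for triangular arrays. -/

section TriangularArray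

variable {Ω E : Type*} {mΩ : MeasurableSpace Ω} {P : Measure Ω} [IsProbabilityMeasure P]
  [MeasurableSpace E]

/-- Weak law of large numbers for arrays with independent, identically distributed rows. -/
theorem tendstoInMeasure_row_mean {X : ∀ n, Fin n → Ω → E} {μ : ℕ → Measure E}
    (hX : ∀ n i, Measurable (X n i)) (hind : ∀ n, iIndepFun (X n) P)
    (hlaw : ∀ n i, P.map (X n i) = μ n) {h : ℕ → E → ℝ} (hh : ∀ n, Measurable (h n))
    (hL2 : ∀ᶠ n in atTop, MemLp (h n) 2 (μ n)) {m C : ℝ}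
    (hmean : Tendsto (fun n => ∫ x, h n x ∂μ n) atTop (𝓝 m))
    (hC : ∀ᶠ n in atTop, ∫ x, h n x ^ 2 ∂μ n ≤ C) :
    TendstoInMeasure P (fun (n : ℕ) ω => (n : ℝ)⁻¹ * ∑ i, h n (X n i ω)) atTop (fun _ => m) := by
  rw [tendstoInMeasure_iff_norm]
  intro ε hε
  -- Chebyshev's bound at level `ε / 2`; the other half of `ε` absorbs the gap between the row
  -- expectation and `m`.
  have hlim : Tendsto (fun n : ℕ => ENNReal.ofReal (C / (ε / 2) ^ 2 * (n : ℝ)⁻¹)) atTop (𝓝 0) := by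
    have := (tendsto_inv_atTop_nhds_zero_nat (𝕜 := ℝ)).const_mul (C / (ε / 2) ^ 2)
    rw [mul_zero] at this
    simpa using ENNReal.tendsto_ofReal this
  refine tendsto_of_tendsto_of_tendsto_of_le_of_le' tendsto_const_nhds hlim
    (Eventually.of_forall fun _ => zero_le) ?_
  filter_upwards [hL2, hC, eventually_gt_atTop 0,
    (tendsto_iff_dist_tendsto_zero.1 hmean).eventually_lt_const (half_pos hε)] with n hn hCn hn0 hd
  have hn0' : (n : ℝ) ≠ 0 := by exact_mod_cast hn0.ne'
  have hLi : ∀ i, MemLp (fun ω => h n (X n i ω)) 2 P := fun i => by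
    have := hn
    rw [← hlaw n i, memLp_map_measure_iff (hh n).aestronglyMeasurable (hX n i).aemeasurable] at this
    exact this
  have hEi : ∀ i, ∫ ω, h n (X n i ω) ∂P = ∫ x, h n x ∂μ n := fun i => by
    rw [← hlaw n i, integral_map (hX n i).aemeasurable (hh n).aestronglyMeasurable]
  have hVi : ∀ i, Var[fun ω => h n (X n i ω); P] ≤ C := fun i => by
    refine (variance_le_expectation_sq (hLi i).1).trans (le_trans (le_of_eq ?_) hCn)
    rw [← hlaw n i, integral_map (hX n i).aemeasurable ((hh n).pow_const 2).aestronglyMeasurable]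
    rfl
  have hsum : Var[∑ i, fun ω => h n (X n i ω); P] = ∑ i, Var[fun ω => h n (X n i ω); P] :=
    IndepFun.variance_sum (fun i _ => hLi i) fun i _ j _ hij =>
      ((hind n).comp (fun _ => h n) fun _ => hh n).indepFun hij
  have hS : MemLp (fun ω => (n : ℝ)⁻¹ * ∑ i, h n (X n i ω)) 2 P :=
    (memLp_finsetSum _ fun i _ => hLi i).const_mul _
  have hmS : ∫ ω, (n : ℝ)⁻¹ * ∑ i, h n (X n i ω) ∂P = ∫ x, h n x ∂μ n := by
    rw [integral_const_mul, integral_finsetSum _ fun i _ => (hLi i).integrable one_le_two]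
    simp [hEi, hn0']
  have hV : Var[fun ω => (n : ℝ)⁻¹ * ∑ i, h n (X n i ω); P] ≤ C * (n : ℝ)⁻¹ := by
    rw [variance_const_mul]
    have e : (fun ω => ∑ i, h n (X n i ω)) = ∑ i, fun ω => h n (X n i ω) := by
      ext ω; simp
    rw [e, hsum]
    calc (n : ℝ)⁻¹ ^ 2 * ∑ i, Var[fun ω => h n (X n i ω); P]
        ≤ (n : ℝ)⁻¹ ^ 2 * ∑ _i : Fin n, C := by
          gcongr with i
          exact hVi i
      _ = C * (n : ℝ)⁻¹ := by
          rw [Finset.sum_const, Finset.card_univ, Fintype.card_fin, nsmul_eq_mul]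
          field_simp
  refine (measure_mono fun ω hω => ?_).trans ((meas_ge_le_variance_div_sq hS (half_pos hε)).trans
    (ENNReal.ofReal_le_ofReal ?_))
  · simp only [Set.mem_ofPred_eq, Real.norm_eq_abs] at hω ⊢
    rw [hmS]
    rw [Real.dist_eq] at hd
    have h3 := abs_sub_le ((n : ℝ)⁻¹ * ∑ i, h n (X n i ω)) (∫ x, h n x ∂μ n) m
    linarith
  · rw [div_mul_eq_mul_div]
    gcongr

/-- Taylor's remainder for `|y| ≤ 1`; beyond that each term is bounded separately, and `2 + |y| +
y²/2` is at most `4|y|³`. -/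
theorem norm_exp_mul_I_sub_taylor_le (y : ℝ) :
    ‖Complex.exp (y * Complex.I) - (1 + y * Complex.I - y ^ 2 / 2)‖ ≤ 4 * |y| ^ 3 := by
  have hy3 : 0 ≤ |y| ^ 3 := by positivity
  have hn : ‖(y : ℂ) * Complex.I‖ = |y| := by simp
  rcases le_or_gt |y| 1 with hy | hy
  · have h := Complex.exp_bound (x := y * Complex.I) (by rw [hn]; exact hy) (n := 3) (by norm_num)
    rw [hn] at h
    have e : ∑ m ∈ Finset.range 3, ((y : ℂ) * Complex.I) ^ m / m.factorial
        = 1 + y * Complex.I - y ^ 2 / 2 := by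
      simp [Finset.sum_range_succ, Nat.factorial, mul_pow]
      ring
    rw [e] at h
    refine h.trans ?_
    norm_num [Nat.factorial]
    linarith
  · have h1 : ‖Complex.exp (y * Complex.I)‖ = 1 := Complex.norm_exp_ofReal_mul_I y
    have h2 : ‖(1 : ℂ) + y * Complex.I - y ^ 2 / 2‖ ≤ 1 + |y| + |y| ^ 2 / 2 := by
      refine (norm_sub_le _ _).trans (add_le_add ((norm_add_le _ _).trans ?_) ?_)
      · rw [hn, norm_one]
      · simp
    refine (norm_sub_le _ _).trans ?_
    rw [h1]
    nlinarith [sq_nonneg (|y| - 1), mul_pos (sub_pos.2 hy) (sub_pos.2 hy), mul_pos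
      (mul_pos (sub_pos.2 hy) (sub_pos.2 hy)) (sub_pos.2 hy)]

/-- Central limit theorem for arrays with independent, identically distributed rows, in terms of
characteristic functions. -/
theorem tendsto_integral_exp_pow {μ : ℕ → Measure E} {h : ℕ → E → ℝ} (hh : ∀ n, Measurable (h n))
    (hprob : ∀ᶠ n in atTop, IsProbabilityMeasure (μ n))
    (hL4 : ∀ᶠ n in atTop, MemLp (h n) 4 (μ n)) {v C : ℝ}
    (hmean : ∀ᶠ n in atTop, ∫ x, h n x ∂μ n = 0)
    (hvar : Tendsto (fun n => ∫ x, h n x ^ 2 ∂μ n) atTop (𝓝 v))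
    (hC : ∀ᶠ n in atTop, ∫ x, h n x ^ 4 ∂μ n ≤ C) :
    Tendsto (fun n : ℕ => (∫ x, Complex.exp (((√n)⁻¹ * h n x : ℝ) * Complex.I) ∂μ n) ^ n) atTop
      (𝓝 (Complex.exp (-v / 2))) := by
  have e : (fun n : ℕ => (∫ x, Complex.exp (((√n)⁻¹ * h n x : ℝ) * Complex.I) ∂μ n) ^ n)
      = fun n : ℕ => (1 + ((∫ x, Complex.exp (((√n)⁻¹ * h n x : ℝ) * Complex.I) ∂μ n) - 1)) ^ n := by
    ext n; rw [add_sub_cancel]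
  rw [e]
  refine Complex.tendsto_one_add_pow_exp_of_tendsto ?_
  have h1 : Tendsto (fun n : ℕ => ((-(∫ x, h n x ^ 2 ∂μ n) / 2 : ℝ) : ℂ)) atTop (𝓝 (-v / 2)) := by
    have := (Complex.continuous_ofReal.tendsto _).comp ((hvar.neg).div_const 2)
    rw [show (-(v : ℂ) / 2) = ((-v / 2 : ℝ) : ℂ) by push_cast; rfl]
    exact this
  have h2 : Tendsto (fun n : ℕ => 4 * (1 + C) * (√n)⁻¹) atTop (𝓝 0) := by
    have := (tendsto_inv_atTop_zero.comp (Real.tendsto_sqrt_atTop.comp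
      tendsto_natCast_atTop_atTop)).const_mul (4 * (1 + C))
    rw [mul_zero] at this
    exact this
  -- As `|h|³ ≤ 1 + h⁴`, the Taylor error is at most `4 n^(-3/2) (1 + C)`, which after
  -- multiplication by `n` is still of order `n^(-1/2)`.
  have h3 : Tendsto (fun n : ℕ => (n : ℂ) * ((∫ x, Complex.exp (((√n)⁻¹ * h n x : ℝ) * Complex.I)
      ∂μ n) - 1) - ((-(∫ x, h n x ^ 2 ∂μ n) / 2 : ℝ) : ℂ)) atTop (𝓝 0) := by
    refine squeeze_zero_norm' ?_ h2
    filter_upwards [hprob, hL4, hmean, hC, eventually_gt_atTop 0] with n hp h4 hm hCn hn0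
    have hn : (0 : ℝ) < n := by exact_mod_cast hn0
    have hs : 0 < √(n : ℝ) := Real.sqrt_pos.2 hn
    have hss : √(n : ℝ) ^ 2 = n := Real.sq_sqrt hn.le
    have i4 : Integrable (fun x => h n x ^ 4) (μ n) := by
      have := h4.integrable_norm_pow (p := 4) (by norm_num)
      refine this.congr (Eventually.of_forall fun x => ?_)
      simp [(show Even 4 by decide).pow_abs]
    have i2 : Integrable (fun x => h n x ^ 2) (μ n) :=
      (h4.mono_exponent (q := 4) (p := 2) (by norm_num)).integrable_sq
    have i1 : Integrable (h n) (μ n) := h4.integrable (by norm_num)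
    have ie : Integrable (fun x => Complex.exp (((√n)⁻¹ * h n x : ℝ) * Complex.I)) (μ n) := by
      have := hh n
      refine Integrable.of_bound (C := 1) (Measurable.aestronglyMeasurable (by fun_prop))
        (Eventually.of_forall fun x => ?_)
      rw [Complex.norm_exp_ofReal_mul_I]
    have it : Integrable (fun x => (1 : ℂ) + ((√n)⁻¹ * h n x : ℝ) * Complex.I
        - (((√n)⁻¹ * h n x : ℝ) : ℂ) ^ 2 / 2) (μ n) := by
      refine ((integrable_const _).add ((i1.const_mul _).ofReal.mul_const _)).sub
        (Integrable.div_const ?_ _)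
      have := (i2.const_mul ((√n)⁻¹ ^ 2)).ofReal (𝕜 := ℂ)
      refine this.congr (Eventually.of_forall fun x => ?_)
      change (((√n)⁻¹ ^ 2 * h n x ^ 2 : ℝ) : ℂ) = _
      rw [← mul_pow, Complex.ofReal_pow]
    have et : ∫ x, ((1 : ℂ) + ((√n)⁻¹ * h n x : ℝ) * Complex.I
        - (((√n)⁻¹ * h n x : ℝ) : ℂ) ^ 2 / 2) ∂μ n
        = 1 + ((-((n : ℝ)⁻¹ * ∫ x, h n x ^ 2 ∂μ n) / 2 : ℝ) : ℂ) := by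
      have e1 : ∀ x, ((1 : ℂ) + ((√n)⁻¹ * h n x : ℝ) * Complex.I
        - (((√n)⁻¹ * h n x : ℝ) : ℂ) ^ 2 / 2) = ((1 - (n : ℝ)⁻¹ * h n x ^ 2 / 2 : ℝ) : ℂ) +
          (((√n)⁻¹ * h n x : ℝ) : ℂ) * Complex.I := by
        intro x
        have : (((√n)⁻¹ * h n x : ℝ) : ℂ) ^ 2 = (((n : ℝ)⁻¹ * h n x ^ 2 : ℝ) : ℂ) := by
          rw [← Complex.ofReal_pow, mul_pow, inv_pow, hss]
        rw [this]
        push_cast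
        ring
      simp_rw [e1]
      rw [integral_add (Integrable.ofReal ((integrable_const _).sub ((i2.const_mul _).div_const _)))
        ((i1.const_mul _).ofReal.mul_const _), integral_mul_const, integral_complex_ofReal,
        integral_complex_ofReal, integral_const_mul, hm, integral_sub (integrable_const _)
        ((i2.const_mul _).div_const _), integral_div, integral_const_mul]
      simp
      ring
    have hb : ‖∫ x, (Complex.exp (((√n)⁻¹ * h n x : ℝ) * Complex.I) -
        ((1 : ℂ) + ((√n)⁻¹ * h n x : ℝ) * Complex.I - (((√n)⁻¹ * h n x : ℝ) : ℂ) ^ 2 / 2)) ∂μ n‖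
        ≤ 4 * (√n)⁻¹ ^ 3 * (1 + C) := by
      calc _ ≤ ∫ x, 4 * (√n)⁻¹ ^ 3 * (1 + h n x ^ 4) ∂μ n := by
            refine norm_integral_le_of_norm_le (((integrable_const _).add i4).const_mul _)
              (Eventually.of_forall fun x => ?_)
            refine (norm_exp_mul_I_sub_taylor_le _).trans ?_
            rw [abs_mul, abs_of_pos (inv_pos.2 hs), mul_pow, ← mul_assoc]
            refine mul_le_mul_of_nonneg_left ?_ (by positivity)
            have e4 : h n x ^ 4 = |h n x| ^ 4 := by rw [(show Even 4 by decide).pow_abs]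
            rw [e4]
            rcases le_or_gt |h n x| 1 with hle | hlt
            · have := pow_le_one₀ (n := 3) (abs_nonneg _) hle
              have : 0 ≤ |h n x| ^ 4 := by positivity
              linarith
            · have := pow_le_pow_right₀ hlt.le (show 3 ≤ 4 by norm_num)
              linarith
        _ = 4 * (√n)⁻¹ ^ 3 * (1 + ∫ x, h n x ^ 4 ∂μ n) := by
            rw [integral_const_mul, integral_add (integrable_const _) i4]
            simp
        _ ≤ _ := by gcongr
    rw [integral_sub ie it, et] at hb
    have ed : (n : ℂ) * ((∫ x, Complex.exp (((√n)⁻¹ * h n x : ℝ) * Complex.I) ∂μ n) - 1)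
        - ((-(∫ x, h n x ^ 2 ∂μ n) / 2 : ℝ) : ℂ)
        = n * ((∫ x, Complex.exp (((√n)⁻¹ * h n x : ℝ) * Complex.I) ∂μ n) -
          (1 + ((-((n : ℝ)⁻¹ * ∫ x, h n x ^ 2 ∂μ n) / 2 : ℝ) : ℂ))) := by
      have hnc : (n : ℂ) ≠ 0 := by exact_mod_cast hn0.ne'
      generalize (∫ x, Complex.exp (((√n)⁻¹ * h n x : ℝ) * Complex.I) ∂μ n) = J
      push_cast
      field_simp
      ring
    rw [ed, norm_mul, Complex.norm_natCast]
    calc (n : ℝ) * _ ≤ n * (4 * (√n)⁻¹ ^ 3 * (1 + C)) := by gcongr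
      _ = 4 * (1 + C) * (√n)⁻¹ := by
        nth_rewrite 1 [← hss]
        field_simp
  have h4 := h3.add h1
  rw [zero_add] at h4
  refine h4.congr fun n => ?_
  ring

end TriangularArray

/-! ### Continuity and quantiles of the chi-square distribution. -/

section ChiSquared

/-- Given the other coordinates, the first one can take at most two values, and the Gaussian law has
no atoms. For `k = 0` the law is a Dirac mass. -/
theorem chiSquared_singleton {k : ℕ} (hk : k ≠ 0) (c : ℝ) : chiSquared k {c} = 0 := by
  obtain ⟨m, rfl⟩ := Nat.exists_eq_succ_of_ne_zero hk
  have hm : Measurable fun z : Fin (m + 1) → ℝ => ∑ i, z i ^ 2 := by fun_prop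
  rw [chiSquared, Measure.map_apply hm (measurableSet_singleton c)]
  have hmp := (measurePreserving_piFinSuccAbove (fun _ : Fin (m + 1) => gaussianReal 0 1) 0).symm
  have hs : MeasurableSet ((fun z : Fin (m + 1) → ℝ => ∑ i, z i ^ 2) ⁻¹' {c}) :=
    hm (measurableSet_singleton c)
  rw [← hmp.measure_preimage hs.nullMeasurableSet,
    Measure.prod_apply_symm (hs.preimage hmp.measurable)]
  have := nullSingletonClass_gaussianReal (μ := 0) (v := 1) one_ne_zero
  refine (lintegral_congr fun y => ?_).trans lintegral_zero
  refine Set.Finite.measure_zero (Set.Finite.subset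
    ((Set.finite_singleton (√(c - ∑ i, y i ^ 2))).insert (-√(c - ∑ i, y i ^ 2))) fun x hx => ?_) _
  simp only [Set.mem_preimage, MeasurableEquiv.piFinSuccAbove_symm_apply, Set.mem_singleton_iff,
    Fin.sum_univ_succ] at hx
  simp at hx
  have h1 : x ^ 2 = c - ∑ i, y i ^ 2 := by linarith
  rw [← h1, Real.sqrt_sq_eq_abs]
  rcases abs_choice x with h | h <;> simp [h]

theorem continuous_cdf_of_noAtoms (μ : Measure ℝ) [IsProbabilityMeasure μ]
    (h : ∀ c, μ {c} = 0) : Continuous (cdf μ) := by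
  refine continuous_iff_continuousAt.2 fun c => ?_
  refine continuousAt_iff_continuous_left'_right'.2 ⟨?_, ?_⟩
  · rw [(monotone_cdf μ).continuousWithinAt_Iio_iff_leftLim_eq]
    have h1 := h c
    rw [← measure_cdf μ, StieltjesFunction.measure_singleton, ENNReal.ofReal_eq_zero] at h1
    exact le_antisymm ((monotone_cdf μ).leftLim_le le_rfl) (by linarith)
  · exact ((cdf μ).right_continuous c).mono Set.Ioi_subset_Ici_self

/-- Continuity makes the infimum attained, and passing to the limit from its left excludes strict
inequality. -/
theorem cdf_chiSquaredUpperQuantile {k : ℕ} (hk : k ≠ 0) {α : ℝ} (h0 : 0 < α) (h1 : α < 1) :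
    cdf (chiSquared k) (chiSquaredUpperQuantile k α) = 1 - α := by
  have hc := continuous_cdf_of_noAtoms (chiSquared k) (chiSquared_singleton hk)
  obtain ⟨a, ha⟩ := ((tendsto_cdf_atBot (chiSquared k)).eventually_lt_const
    (sub_pos.2 h1)).exists
  obtain ⟨b, hb⟩ := ((tendsto_cdf_atTop (chiSquared k)).eventually_const_lt
    (sub_lt_self 1 h0)).exists
  have hbdd : BddBelow {x : ℝ | 1 - α ≤ cdf (chiSquared k) x} := by
    refine ⟨a, fun x hx => ?_⟩
    by_contra hlt
    exact absurd (monotone_cdf _ (not_le.1 hlt).le) (not_le.2 (ha.trans_le hx))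
  have hne : {x : ℝ | 1 - α ≤ cdf (chiSquared k) x}.Nonempty := ⟨b, hb.le⟩
  have hmem := (isClosed_le continuous_const hc).csInf_mem hne hbdd
  refine le_antisymm ?_ hmem
  refine le_of_tendsto (hc.continuousAt.continuousWithinAt
    (s := Set.Iio (chiSquaredUpperQuantile k α))) ?_
  filter_upwards [self_mem_nhdsWithin] with x hx
  exact (not_le.1 fun h => not_le.2 hx (csInf_le hbdd h)).le

end ChiSquared

/-! ### The Gaussian law on the tangent space. -/

section GaussianLimit

variable {p : ℕ} {θ : EuclideanSpace ℝ (Fin p)}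

theorem dotProduct_one_sub_vecMulVec (x : EuclideanSpace ℝ (Fin p)) :
    x.ofLp ⬝ᵥ (1 - Matrix.vecMulVec θ.ofLp θ.ofLp).mulVec x.ofLp = ‖x‖ ^ 2 - ⟪x, θ⟫_ℝ ^ 2 := by
  have h : ⟪x, θ⟫_ℝ = θ.ofLp ⬝ᵥ x.ofLp := by
    simp [EuclideanSpace.inner_eq_star_dotProduct]
  have h' : ‖x‖ ^ 2 = x.ofLp ⬝ᵥ x.ofLp := by
    rw [← real_inner_self_eq_norm_sq, EuclideanSpace.inner_eq_star_dotProduct, star_trivial]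
  rw [Matrix.sub_mulVec, Matrix.one_mulVec, dotProduct_sub, Matrix.vecMulVec_mulVec, h, h']
  simp [dotProduct_comm x.ofLp θ.ofLp]
  ring

theorem posSemidef_one_sub_vecMulVec (hθ : ‖θ‖ = 1) :
    (1 - Matrix.vecMulVec θ.ofLp θ.ofLp).PosSemidef := by
  refine Matrix.PosSemidef.of_dotProduct_mulVec_nonneg ?_ fun x => ?_
  · refine Matrix.isHermitian_one.sub ?_
    ext i j
    simp [Matrix.vecMulVec_apply, mul_comm]
  · have h := dotProduct_one_sub_vecMulVec (θ := θ) (WithLp.toLp 2 x)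
    rw [star_trivial, h, ← norm_sub_inner_smul_sq hθ]
    positivity

theorem charFun_tangentGaussian (hθ : ‖θ‖ = 1) (t : EuclideanSpace ℝ (Fin p)) :
    charFun (multivariateGaussian 0 (1 - Matrix.vecMulVec θ.ofLp θ.ofLp)) t
      = Complex.exp (-((‖t‖ ^ 2 - ⟪t, θ⟫_ℝ ^ 2 : ℝ) : ℂ) / 2) := by
  rw [charFun_multivariateGaussian (posSemidef_one_sub_vecMulVec hθ),
    dotProduct_one_sub_vecMulVec, inner_zero_right]
  congr 1
  simp
  ring

/-- The characteristic functions agree, as a vector of `θᗮ` sees only the projection of `t`. In this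
form squared norms become sums of `p - 1` squares of independent standard normals. -/
theorem tangentGaussian_eq_map (hθ : ‖θ‖ = 1) :
    multivariateGaussian 0 (1 - Matrix.vecMulVec θ.ofLp θ.ofLp)
      = (stdGaussian (ℝ ∙ θ)ᗮ).map (fun w : (ℝ ∙ θ)ᗮ => (w : EuclideanSpace ℝ (Fin p))) := by
  have : IsProbabilityMeasure ((stdGaussian (ℝ ∙ θ)ᗮ).map
      (fun w : (ℝ ∙ θ)ᗮ => (w : EuclideanSpace ℝ (Fin p)))) :=
    Measure.isProbabilityMeasure_map (by fun_prop)
  refine Measure.ext_of_charFun ?_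
  ext t
  let k : (ℝ ∙ θ)ᗮ := ⟨t - ⟪t, θ⟫_ℝ • θ,
    (Submodule.mem_orthogonal_singleton_iff_inner_left).2 (inner_sub_inner_smul_right hθ t)⟩
  have hk : ∀ w : (ℝ ∙ θ)ᗮ, ⟪(w : EuclideanSpace ℝ (Fin p)), t⟫_ℝ = ⟪w, k⟫_ℝ := by
    intro w
    have h0 := (Submodule.mem_orthogonal_singleton_iff_inner_left).1 w.2
    rw [Submodule.coe_inner]
    simp [k, inner_sub_right, real_inner_smul_right, h0]
  rw [charFun_tangentGaussian hθ, charFun_apply, integral_map (by fun_prop)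
    (Measurable.aestronglyMeasurable (by fun_prop))]
  simp_rw [hk]
  rw [← charFun_apply, charFun_stdGaussian, ← norm_sub_inner_smul_sq hθ]
  congr 1
  push_cast
  rfl

/-- The constant `c` plays no role because the law is carried by `θᗮ`; leaving it free serves both
chi-square statistics. -/
theorem map_tangentGaussian_eq_chiSquared (hθ : ‖θ‖ = 1) (c : ℝ) :
    (multivariateGaussian 0 (1 - Matrix.vecMulVec θ.ofLp θ.ofLp)).map
      (fun x => ‖x‖ ^ 2 - c * ⟪x, θ⟫_ℝ ^ 2) = chiSquared (p - 1) := by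
  have hθ0 : θ ≠ 0 := fun h => by simp [h] at hθ
  have hK : Module.finrank ℝ (ℝ ∙ θ)ᗮ = p - 1 := by
    have h1 := (ℝ ∙ θ).finrank_add_finrank_orthogonal
    rw [finrank_span_singleton hθ0, finrank_euclideanSpace, Fintype.card_fin] at h1
    omega
  let b := (stdOrthonormalBasis ℝ (ℝ ∙ θ)ᗮ).reindex (finCongr hK)
  rw [tangentGaussian_eq_map hθ, Measure.map_map (by fun_prop) (by fun_prop),
    stdGaussian_eq_map_pi_orthonormalBasis b, Measure.map_map (by fun_prop) (by fun_prop),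
    chiSquared]
  congr 1
  ext z
  simp only [Function.comp_apply]
  have h0 := (Submodule.mem_orthogonal_singleton_iff_inner_left).1 (∑ i, z i • b i).2
  rw [h0]
  have h1 : ‖((∑ i, z i • b i : (ℝ ∙ θ)ᗮ) : EuclideanSpace ℝ (Fin p))‖ ^ 2
      = ‖∑ i, z i • b i‖ ^ 2 := rfl
  rw [h1, ← b.sum_sq_inner_right]
  simp [-Submodule.coe_inner, b.orthonormal.inner_right_fintype]

end GaussianLimit

/-! ### Events that coincide with probability tending to one. -/

section MeasureComparison

/-- Up to null sets, `A i` and `B i` differ only inside `{Y i ∉ U}`, whose probability vanishes in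
the limit. -/
theorem tendsto_measure_of_tendstoInMeasure {Ω ι F : Type*} {mΩ : MeasurableSpace Ω}
    {P : Measure Ω} [IsProbabilityMeasure P] {l : Filter ι} [PseudoMetricSpace F]
    {Y : ι → Ω → F} {c : F} (hY : TendstoInMeasure P Y l (fun _ => c)) {U : Set F} (hU : U ∈ 𝓝 c)
    {A B : ι → Set Ω} {b : ENNReal} (hB : Tendsto (fun i => P (B i)) l (𝓝 b))
    (h : ∀ᶠ i in l, ∀ᵐ ω ∂P, Y i ω ∈ U → (ω ∈ A i ↔ ω ∈ B i)) :
    Tendsto (fun i => P (A i)) l (𝓝 b) := by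
  have hbad := tendstoInMeasure_const_iff.1 hY U hU
  have h1 := hB.add hbad
  have h2 := ENNReal.Tendsto.sub hB hbad (Or.inr ENNReal.zero_ne_top)
  rw [add_zero] at h1
  rw [tsub_zero] at h2
  refine tendsto_of_tendsto_of_tendsto_of_le_of_le' h2 h1 ?_ ?_
  · filter_upwards [h] with i hi
    refine tsub_le_iff_right.2 ((measure_mono_ae ?_).trans (measure_union_le _ _))
    filter_upwards [hi] with ω hω hB
    by_cases hYU : Y i ω ∈ U
    · exact Or.inl ((hω hYU).2 hB)
    · exact Or.inr hYU
  · filter_upwards [h] with i hi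
    refine (measure_mono_ae ?_).trans (measure_union_le _ _)
    filter_upwards [hi] with ω hω hA
    by_cases hYU : Y i ω ∈ U
    · exact Or.inl ((hω hYU).1 hA)
    · exact Or.inr hYU

end MeasureComparison

/-! ### Deterministic identities and bounds for the spherical mean. -/

section SphericalMeanAlgebra

variable {n p : ℕ}

theorem measurable_sampleMean :
    Measurable (sampleMean : (Fin n → EuclideanSpace ℝ (Fin p)) → _) := by
  unfold sampleMean
  fun_prop

theorem measurable_sphericalMean :
    Measurable (sphericalMean : (Fin n → EuclideanSpace ℝ (Fin p)) → _) := by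
  have := measurable_sampleMean (n := n) (p := p)
  unfold sphericalMean
  fun_prop

theorem measurable_eHatTwo :
    Measurable (eHatTwo : (Fin n → EuclideanSpace ℝ (Fin p)) → _) := by
  have := measurable_sphericalMean (n := n) (p := p)
  unfold eHatTwo
  fun_prop

variable {θ : EuclideanSpace ℝ (Fin p)} {x : Fin n → EuclideanSpace ℝ (Fin p)}

theorem norm_sampleMean_pos (h : 0 < ⟪sampleMean x, θ⟫_ℝ) : 0 < ‖sampleMean x‖ :=
  norm_pos_iff.2 fun h0 => by simp [h0] at h

theorem norm_sphericalMean (h : 0 < ⟪sampleMean x, θ⟫_ℝ) : ‖sphericalMean x‖ = 1 := by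
  have h0 := norm_sampleMean_pos h
  rw [sphericalMean, norm_smul, norm_inv, norm_norm, inv_mul_cancel₀ h0.ne']

theorem norm_sampleMean_sq (hθ : ‖θ‖ = 1) :
    ‖sampleMean x‖ ^ 2 = ⟪sampleMean x, θ⟫_ℝ ^ 2 +
      ‖sampleMean x - ⟪sampleMean x, θ⟫_ℝ • θ‖ ^ 2 := by
  rw [norm_sub_inner_smul_sq hθ]
  ring

theorem norm_sphericalMean_sub_sq (hθ : ‖θ‖ = 1) (h : 0 < ⟪sampleMean x, θ⟫_ℝ) :
    ‖sphericalMean x - θ‖ ^ 2 = 2 * (1 - ⟪θ, sphericalMean x⟫_ℝ) := by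
  rw [norm_sub_sq_real, norm_sphericalMean h, hθ, real_inner_comm]
  ring

/-- If `φ` is the angle between the sample mean and `θ`, this is `2 sin(φ/2) ≤ tan φ`. -/
theorem norm_sphericalMean_sub_le (hθ : ‖θ‖ = 1) (h : 0 < ⟪sampleMean x, θ⟫_ℝ) :
    ‖sphericalMean x - θ‖ ≤
      ‖sampleMean x - ⟪sampleMean x, θ⟫_ℝ • θ‖ / ⟪sampleMean x, θ⟫_ℝ := by
  have hN := norm_sampleMean_pos h
  have hsq := norm_sampleMean_sq (x := x) hθ
  refine abs_le_of_sq_le_sq' ?_ (by positivity) |>.2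
  rw [norm_sphericalMean_sub_sq hθ h, sphericalMean, real_inner_smul_right, real_inner_comm]
  set N := ‖sampleMean x‖
  set u := ⟪sampleMean x, θ⟫_ℝ
  set T := ‖sampleMean x - u • θ‖
  have huN : u ≤ N := by nlinarith [sq_nonneg T]
  rw [div_pow, le_div_iff₀ (by positivity)]
  have e : T ^ 2 = (N - u) * (N + u) := by linarith
  rw [e]
  have h1 : 2 * (1 - N⁻¹ * u) * u ^ 2 = (N - u) * (2 * u ^ 2 / N) := by field_simp
  rw [h1]
  refine mul_le_mul_of_nonneg_left ?_ (sub_nonneg.2 huN)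
  rw [div_le_iff₀ hN]
  nlinarith

/-- Pythagoras rewrites the axial defect `1 - ⟪sampleMean, θ⟫ / ‖sampleMean‖` as a term quadratic in
the tangential part, which makes it visibly of second order. -/
theorem sphericalMean_sub_eq (hθ : ‖θ‖ = 1) (h : 0 < ⟪sampleMean x, θ⟫_ℝ) :
    sphericalMean x - θ = ‖sampleMean x‖⁻¹ • (sampleMean x - ⟪sampleMean x, θ⟫_ℝ • θ) -
      (‖sampleMean x - ⟪sampleMean x, θ⟫_ℝ • θ‖ ^ 2 /
        (‖sampleMean x‖ * (‖sampleMean x‖ + ⟪sampleMean x, θ⟫_ℝ))) • θ := by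
  have hN := norm_sampleMean_pos h
  have hsq := norm_sampleMean_sq (x := x) hθ
  have e : ‖sampleMean x - ⟪sampleMean x, θ⟫_ℝ • θ‖ ^ 2 /
        (‖sampleMean x‖ * (‖sampleMean x‖ + ⟪sampleMean x, θ⟫_ℝ))
        = 1 - ‖sampleMean x‖⁻¹ * ⟪sampleMean x, θ⟫_ℝ := by
    have : ‖sampleMean x‖ + ⟪sampleMean x, θ⟫_ℝ ≠ 0 := by positivity
    rw [div_eq_iff (by positivity)]
    field_simp
    linarith
  rw [e, sphericalMean]
  module

/-- The bound `2 ‖θ' - θ‖` would be too weak after multiplication by `g`. The tangential factor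
shares the scale out: each of the two small lengths takes one `√g`. -/
theorem abs_inner_sq_sub_inner_sq_le {θ' y : EuclideanSpace ℝ (Fin p)} (hθ : ‖θ‖ = 1)
    (hθ' : ‖θ'‖ = 1) (hy : ‖y‖ = 1) :
    |⟪y, θ⟫_ℝ ^ 2 - ⟪y, θ'⟫_ℝ ^ 2|
      ≤ 2 * (‖y - ⟪y, θ⟫_ℝ • θ‖ * ‖θ' - θ‖) + ‖θ' - θ‖ ^ 2 := by
  -- For unit vectors `⟪θ, θ' - θ⟫ = -‖θ' - θ‖² / 2`, so the axial part is of second order.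
  have h1 : ⟪y, θ' - θ⟫_ℝ = ⟪y - ⟪y, θ⟫_ℝ • θ, θ' - θ⟫_ℝ - ⟪y, θ⟫_ℝ * (‖θ' - θ‖ ^ 2 / 2) := by
    rw [norm_sub_sq_real, inner_sub_left, real_inner_smul_left, inner_sub_right θ,
      real_inner_self_eq_norm_sq, hθ, hθ', real_inner_comm θ' θ]
    ring
  have hu := abs_real_inner_le_norm y θ
  have hu' := abs_real_inner_le_norm y θ'
  have ht := abs_real_inner_le_norm (y - ⟪y, θ⟫_ℝ • θ) (θ' - θ)
  rw [hy, hθ, mul_one] at hu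
  rw [hy, hθ', mul_one] at hu'
  have h2 : |⟪y, θ' - θ⟫_ℝ| ≤ ‖y - ⟪y, θ⟫_ℝ • θ‖ * ‖θ' - θ‖ + ‖θ' - θ‖ ^ 2 / 2 := by
    rw [h1]
    refine (abs_sub _ _).trans (add_le_add ht ?_)
    rw [abs_mul, abs_of_nonneg (by positivity : (0 : ℝ) ≤ ‖θ' - θ‖ ^ 2 / 2)]
    exact mul_le_of_le_one_left (by positivity) hu
  have h3 : ⟪y, θ⟫_ℝ ^ 2 - ⟪y, θ'⟫_ℝ ^ 2 = -(⟪y, θ' - θ⟫_ℝ * (⟪y, θ⟫_ℝ + ⟪y, θ'⟫_ℝ)) := by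
    rw [inner_sub_right]
    ring
  have h4 : |⟪y, θ⟫_ℝ + ⟪y, θ'⟫_ℝ| ≤ 2 := (abs_add_le _ _).trans (by linarith)
  rw [h3, abs_neg, abs_mul]
  calc |⟪y, θ' - θ⟫_ℝ| * |⟪y, θ⟫_ℝ + ⟪y, θ'⟫_ℝ|
      ≤ (‖y - ⟪y, θ⟫_ℝ • θ‖ * ‖θ' - θ‖ + ‖θ' - θ‖ ^ 2 / 2) * 2 :=
        mul_le_mul h2 h4 (abs_nonneg _) (by positivity)
    _ = _ := by ring

/-- The estimator `eHatTwo` is close to the empirical second moment along `θ`. -/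
theorem abs_mul_one_sub_eHatTwo_sub_le (hn : 0 < n) (hθ : ‖θ‖ = 1) (hx : ∀ i, ‖x i‖ = 1)
    (h : 0 < ⟪sampleMean x, θ⟫_ℝ) {g : ℝ} (hg : 0 ≤ g) :
    |g * (1 - eHatTwo x) - (n : ℝ)⁻¹ * ∑ i, g * (1 - ⟪x i, θ⟫_ℝ ^ 2)|
      ≤ √g * ‖sphericalMean x - θ‖ * ((n : ℝ)⁻¹ * ∑ i, g * (1 - ⟪x i, θ⟫_ℝ ^ 2) + 1)
        + (√g * ‖sphericalMean x - θ‖) ^ 2 := by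
  have hn' : (n : ℝ) ≠ 0 := by exact_mod_cast hn.ne'
  have hsum : ∀ c : ℝ, c = (n : ℝ)⁻¹ * ∑ _i : Fin n, c := fun c => by
    rw [Finset.sum_const, Finset.card_univ, Fintype.card_fin, nsmul_eq_mul, inv_mul_cancel_left₀ hn']
  set δ := ‖sphericalMean x - θ‖
  have hδ : 0 ≤ δ := norm_nonneg _
  have hsg := Real.sq_sqrt hg
  have e1 : g * (1 - eHatTwo x) - (n : ℝ)⁻¹ * ∑ i, g * (1 - ⟪x i, θ⟫_ℝ ^ 2)
      = (n : ℝ)⁻¹ * ∑ i, g * (⟪x i, θ⟫_ℝ ^ 2 - ⟪x i, sphericalMean x⟫_ℝ ^ 2) := by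
    rw [eHatTwo]
    nth_rewrite 1 [hsum 1]
    rw [← mul_sub, ← Finset.sum_sub_distrib, mul_left_comm, ← mul_sub, Finset.mul_sum,
      ← Finset.sum_sub_distrib]
    congr 1
    refine Finset.sum_congr rfl fun i _ => ?_
    ring
  have e2 : √g * δ * ((n : ℝ)⁻¹ * ∑ i, g * (1 - ⟪x i, θ⟫_ℝ ^ 2) + 1) + (√g * δ) ^ 2
      = (n : ℝ)⁻¹ * ∑ i, (√g * δ * (g * (1 - ⟪x i, θ⟫_ℝ ^ 2) + 1) + (√g * δ) ^ 2) := by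
    simp only [Finset.sum_add_distrib, ← Finset.mul_sum, Finset.sum_const, Finset.card_univ,
      Fintype.card_fin, nsmul_eq_mul]
    field_simp
  rw [e1, e2, abs_mul, abs_of_nonneg (by positivity : (0 : ℝ) ≤ (n : ℝ)⁻¹)]
  refine mul_le_mul_of_nonneg_left ((Finset.abs_sum_le_sum_abs _ _).trans
    (Finset.sum_le_sum fun i _ => ?_)) (by positivity)
  rw [abs_mul, abs_of_nonneg hg]
  have h1 := abs_inner_sq_sub_inner_sq_le hθ (norm_sphericalMean h) (hx i)
  have h2 := norm_sub_inner_smul_sq hθ (x i)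
  rw [hx i, one_pow] at h2
  rw [← h2]
  set t := ‖x i - ⟪x i, θ⟫_ℝ • θ‖
  have h3 := mul_le_mul_of_nonneg_left h1 hg
  refine h3.trans ?_
  -- This is `2 √g t ≤ g t² + 1`, which trades the linear term for one whose average obeys the law
  -- of large numbers.
  have h4 : 0 ≤ √g * δ * (√g * t - 1) ^ 2 := by positivity
  have h5 : g * (2 * (t * δ) + δ ^ 2) = √g * δ * (2 * (√g * t)) + (√g * δ) ^ 2 := by
    nth_rewrite 1 [← hsg]
    ring
  have h6 : g * t ^ 2 = (√g * t) ^ 2 := by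
    nth_rewrite 1 [← hsg]
    ring
  change g * (2 * (t * δ) + δ ^ 2) ≤ _
  rw [h5, h6]
  linarith

/-- Stochastic expansion of the studentized spherical mean in terms of the rescaled tangential
component `S` of the sample mean. -/
theorem studentized_sphericalMean_eq (hθ : ‖θ‖ = 1) (h : 0 < ⟪sampleMean x, θ⟫_ℝ) (hn : 0 < n)
    {g : ℝ} (hg : 0 < g) (he : 0 < 1 - eHatTwo x) {S : EuclideanSpace ℝ (Fin p)}
    (hS : S = √(n * g) • (sampleMean x - ⟪sampleMean x, θ⟫_ℝ • θ)) :
    (√(n * ((p : ℝ) - 1)) / √(1 - eHatTwo x)) • (sphericalMean x - θ)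
      = (√((p : ℝ) - 1) / (√(g * (1 - eHatTwo x)) * ‖sampleMean x‖)) • S
        + (-(√((p : ℝ) - 1) / √(g * (1 - eHatTwo x)) / (‖sampleMean x‖ * (‖sampleMean x‖ +
            ⟪sampleMean x, θ⟫_ℝ)) * (√(n * g))⁻¹) * ‖S‖ ^ 2) • θ := by
  have hN := norm_sampleMean_pos h
  have hn' : (0 : ℝ) < n := by exact_mod_cast hn
  have hng : 0 < √(n * g) := Real.sqrt_pos.2 (by positivity)
  have hsg : 0 < √g := Real.sqrt_pos.2 hg
  have hse : 0 < √(1 - eHatTwo x) := Real.sqrt_pos.2 he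
  have hNu : ‖sampleMean x‖ + ⟪sampleMean x, θ⟫_ℝ ≠ 0 := by positivity
  rw [sphericalMean_sub_eq hθ h, hS, norm_smul, Real.norm_of_nonneg hng.le, smul_sub, smul_smul,
    smul_smul, smul_smul, Real.sqrt_mul hg.le, Real.sqrt_mul hn'.le, Real.sqrt_mul hn'.le,
    sub_eq_add_neg, ← neg_smul]
  have hsn : 0 < √(n : ℝ) := Real.sqrt_pos.2 hn'
  congr 2
  · field_simp
  · field_simp

end SphericalMeanAlgebra

/-! ### Concentrating axial laws and the tangential central limit theorem. -/

section AxialArray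

variable {p : ℕ} {θ : EuclideanSpace ℝ (Fin p)}

/-- A sequence of axially symmetric laws concentrating around `θ` at scale `g n`. -/
structure IsConcentrating (θ : EuclideanSpace ℝ (Fin p))
    (μ : ℕ → Measure (EuclideanSpace ℝ (Fin p))) (g : ℕ → ℝ) : Prop where
  axial : ∀ᶠ n in atTop, IsAxialLaw θ (μ n)
  scale : Tendsto g atTop atTop
  first_moment : Tendsto (fun n => g n * ∫ x, (1 - ⟪x, θ⟫_ℝ) ∂μ n) atTop (𝓝 (((p : ℝ) - 1) / 2))
  second_moment : ∃ L, Tendsto (fun n => g n ^ 2 * ∫ x, (1 - ⟪x, θ⟫_ℝ) ^ 2 ∂μ n) atTop (𝓝 L)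

/-- With `a = (p-3)/2`, the first Gamma ratio is `a + 1 = (p-1)/2`; for the second moment only the
existence of a limit matters. -/
theorem rotLaw_isConcentrating (hp : 2 ≤ p) (hθ : ‖θ‖ = 1) {f : ℝ → ℝ} (hf : IsAngularFunction f)
    {κ : ℕ → ℝ} (hκ : Tendsto κ atTop atTop)
    (hprob : ∀ᶠ n in atTop, IsProbabilityMeasure (rotLaw θ (κ n) f)) :
    IsConcentrating θ (fun n => rotLaw θ (κ n) f) fun n => κ n * logDerivFun f (κ n) := by
  have hm := hf.monotone.measurable
  have hp' : (2 : ℝ) ≤ p := by exact_mod_cast hp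
  have ha : -1 < ((p : ℝ) - 3) / 2 := by linarith
  have key : ∀ k : ℕ, Tendsto (fun n => (κ n * logDerivFun f (κ n)) ^ k *
      ∫ x, (1 - ⟪x, θ⟫_ℝ) ^ k ∂(rotLaw θ (κ n) f)) atTop
      (𝓝 (Real.Gamma (((p : ℝ) - 3) / 2 + k + 1) / Real.Gamma (((p : ℝ) - 3) / 2 + 1))) := by
    intro k
    refine ((hf.tendsto_moment_ratio ha k).comp hκ).congr' ?_
    filter_upwards [hprob] with n hn
    rw [integral_rotLaw hp hθ hm hf.nonneg hn (h := fun s => (1 - s) ^ k) (by fun_prop)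
      fun s hs => pow_nonneg (by linarith [hs.2]) _]
    rfl
  refine ⟨?_, hf.tendsto_atTop.comp hκ, ?_, ⟨_, key 2⟩⟩
  · filter_upwards [hprob] with n hn using rotLaw_isAxialLaw hp hm hn
  · have h := key 1
    simp only [pow_one, Nat.cast_one] at h
    rw [Real.Gamma_add_one (by linarith), mul_div_cancel_right₀ _
      (Real.Gamma_pos_of_pos (by linarith)).ne'] at h
    convert h using 2
    ring

namespace IsConcentrating

variable {μ : ℕ → Measure (EuclideanSpace ℝ (Fin p))} {g : ℕ → ℝ}

theorem tendsto_integral_one_sub_inner (hμ : IsConcentrating θ μ g) :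
    Tendsto (fun n => ∫ x, (1 - ⟪x, θ⟫_ℝ) ∂μ n) atTop (𝓝 0) := by
  refine (hμ.first_moment.div_atTop hμ.scale).congr' ?_
  filter_upwards [hμ.scale.eventually_gt_atTop 0] with n hn
  field_simp

theorem integrable_axial (hθ : ‖θ‖ = 1) {ν : Measure (EuclideanSpace ℝ (Fin p))}
    (hν : IsAxialLaw θ ν) {F : ℝ → ℝ} (hF : Continuous F) : Integrable (fun x => F ⟪x, θ⟫_ℝ) ν := by
  obtain ⟨C, hC⟩ := (isCompact_Icc (a := (-1 : ℝ)) (b := 1)).exists_bound_of_continuousOn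
    hF.continuousOn
  refine hν.integrable_of_bound (by fun_prop) (C := C) fun x hx => hC _ ?_
  have := abs_real_inner_le_norm x θ
  rw [hx, hθ, mul_one] at this
  exact abs_le.1 this

/-- Since `1 - u² = 2(1-u) - (1-u)²` and the last term has expectation of order `g⁻²`, the limit is
twice that of the first moment. -/
theorem tendsto_mul_integral_one_sub_inner_sq (hθ : ‖θ‖ = 1) (hμ : IsConcentrating θ μ g) :
    Tendsto (fun n => g n * ∫ x, (1 - ⟪x, θ⟫_ℝ ^ 2) ∂μ n) atTop (𝓝 ((p : ℝ) - 1)) := by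
  obtain ⟨L, hL⟩ := hμ.second_moment
  have h1 := (hμ.first_moment.const_mul 2).sub (hL.div_atTop hμ.scale)
  rw [mul_div_cancel₀ _ (two_ne_zero' ℝ), sub_zero] at h1
  refine h1.congr' ?_
  filter_upwards [hμ.scale.eventually_gt_atTop 0, hμ.axial] with n hn hax
  have i1 : Integrable (fun x => 2 * (1 - ⟪x, θ⟫_ℝ)) (μ n) :=
    integrable_axial hθ hax (F := fun u => 2 * (1 - u)) (by fun_prop)
  have i2 : Integrable (fun x => (1 - ⟪x, θ⟫_ℝ) ^ 2) (μ n) :=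
    integrable_axial hθ hax (F := fun u => (1 - u) ^ 2) (by fun_prop)
  have e : ∀ x, 1 - ⟪x, θ⟫_ℝ ^ 2 = 2 * (1 - ⟪x, θ⟫_ℝ) - (1 - ⟪x, θ⟫_ℝ) ^ 2 := fun x => by ring
  simp_rw [e]
  rw [integral_sub i1 i2, integral_const_mul]
  field_simp

/-- From `(1+u)² ≤ 4`. The bound serves both the law of large numbers for `1 - ⟪x, θ⟫²` and the
fourth-moment condition of the central limit theorem. -/
theorem eventually_integral_sq_le (hθ : ‖θ‖ = 1) (hμ : IsConcentrating θ μ g) :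
    ∃ C, ∀ᶠ n in atTop, ∫ x, (g n * (1 - ⟪x, θ⟫_ℝ ^ 2)) ^ 2 ∂μ n ≤ C := by
  obtain ⟨L, hL⟩ := hμ.second_moment
  refine ⟨4 * (L + 1), ?_⟩
  filter_upwards [hμ.axial, hL.eventually_lt_const (lt_add_one L)] with n hax hn
  refine le_trans ?_ (mul_le_mul_of_nonneg_left hn.le (by norm_num))
  rw [← integral_const_mul, ← integral_const_mul]
  refine integral_mono_ae (integrable_axial hθ hax (F := fun u => (g n * (1 - u ^ 2)) ^ 2)
    (by fun_prop)) (integrable_axial hθ hax (F := fun u => 4 * (g n ^ 2 * (1 - u) ^ 2))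
    (by fun_prop)) ?_
  filter_upwards [hax.norm_eq_one] with x hx
  have := abs_real_inner_le_norm x θ
  rw [hx, hθ, mul_one] at this
  obtain ⟨h1, h2⟩ := abs_le.1 this
  have e : (g n * (1 - ⟪x, θ⟫_ℝ ^ 2)) ^ 2
      = (1 + ⟪x, θ⟫_ℝ) ^ 2 * (g n ^ 2 * (1 - ⟪x, θ⟫_ℝ) ^ 2) := by ring
  rw [e]
  refine mul_le_mul_of_nonneg_right ?_ (by positivity)
  nlinarith

variable {Ω : Type*} {mΩ : MeasurableSpace Ω} {P : Measure Ω} [IsProbabilityMeasure P]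
  {X : ∀ n, Fin n → Ω → EuclideanSpace ℝ (Fin p)}

/-- Central limit theorem for the tangential component of the sample mean. -/
theorem tendstoInDistribution_tangential (hp : 2 ≤ p) (hθ : ‖θ‖ = 1)
    (hμ : IsConcentrating θ μ g) (hX : ∀ n i, Measurable (X n i))
    (hind : ∀ n, iIndepFun (X n) P) (hlaw : ∀ n i, P.map (X n i) = μ n) :
    TendstoInDistribution (fun n ω => √(n * g n) • (sampleMean (fun i => X n i ω) -
        ⟪sampleMean (fun i => X n i ω), θ⟫_ℝ • θ)) atTop id (fun _ => P)
      (multivariateGaussian 0 (1 - Matrix.vecMulVec θ.ofLp θ.ofLp)) := by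
  have hp' : (2 : ℝ) ≤ p := by exact_mod_cast hp
  have hmeas : ∀ n, Measurable fun ω => √(n * g n) • (sampleMean (fun i => X n i ω) -
        ⟪sampleMean (fun i => X n i ω), θ⟫_ℝ • θ) := fun n => by
    have : Measurable fun ω => sampleMean (fun i => X n i ω) :=
      measurable_sampleMean.comp (by fun_prop)
    fun_prop
  refine ⟨fun n => (hmeas n).aemeasurable, aemeasurable_id, ?_⟩
  refine ProbabilityMeasure.tendsto_iff_tendsto_charFun.2 fun t => ?_
  simp only [ProbabilityMeasure.coe_mk, Measure.map_id]
  rw [charFun_tangentGaussian hθ, ← norm_sub_inner_smul_sq hθ]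
  -- Projection is self-adjoint, so testing the tangential mean against `t` is testing the
  -- observations against `t'`.
  set t' := t - ⟪t, θ⟫_ℝ • θ with ht'
  have ht0 : ⟪t', θ⟫_ℝ = 0 := inner_sub_inner_smul_right hθ t
  obtain ⟨C, hC⟩ := hμ.eventually_integral_sq_le hθ
  have hh : ∀ n, Measurable fun x : EuclideanSpace ℝ (Fin p) => √(g n) * ⟪t', x⟫_ℝ :=
    fun n => by fun_prop
  have hclt := tendsto_integral_exp_pow (μ := μ) (h := fun n x => √(g n) * ⟪t', x⟫_ℝ)
    (v := ‖t'‖ ^ 2) (C := ‖t'‖ ^ 4 * C) hh ?_ ?_ ?_ ?_ ?_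
  · push_cast at hclt
    push_cast
    refine hclt.congr' ?_
    filter_upwards [eventually_gt_atTop 0, hμ.scale.eventually_gt_atTop 0] with n hn0 hg
    have hn : (0 : ℝ) < n := by exact_mod_cast hn0
    let Y : Fin n → Ω → ℝ := fun i ω => (√n)⁻¹ * (√(g n) * ⟪t', X n i ω⟫_ℝ)
    have hk : Measurable fun x : EuclideanSpace ℝ (Fin p) => (√(n : ℝ))⁻¹ * (√(g n) * ⟪t', x⟫_ℝ) := by
      fun_prop
    have hYm : ∀ i, Measurable (Y i) := fun i => hk.comp (hX n i)
    have hYi : iIndepFun Y P := (hind n).comp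
      (fun _ x => (√n)⁻¹ * (√(g n) * ⟪t', x⟫_ℝ)) fun _ => hk
    have hsum : ∀ ω, ⟪√(n * g n) • (sampleMean (fun i => X n i ω) -
        ⟪sampleMean (fun i => X n i ω), θ⟫_ℝ • θ), t⟫_ℝ = ∑ i, Y i ω := by
      intro ω
      rw [real_inner_smul_left, inner_sub_inner_smul_comm, ← ht', sampleMean,
        real_inner_smul_right, inner_sum, ← Finset.mul_sum, ← Finset.mul_sum, ← mul_assoc,
        ← mul_assoc, Real.sqrt_mul hn.le]
      congr 1
      have := Real.sq_sqrt hn.le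
      have h0 : √(n : ℝ) ≠ 0 := (Real.sqrt_pos.2 hn).ne'
      nth_rewrite 2 [← this]
      field_simp
    have h1 : charFun (P.map (fun ω => √(n * g n) • (sampleMean (fun i => X n i ω) -
        ⟪sampleMean (fun i => X n i ω), θ⟫_ℝ • θ))) t = charFun (P.map fun ω => ∑ i, Y i ω) 1 := by
      rw [charFun_apply, integral_map (hmeas n).aemeasurable
        (Measurable.aestronglyMeasurable (by fun_prop)), charFun_apply_real,
        integral_map (by fun_prop) (Measurable.aestronglyMeasurable (by fun_prop))]
      simp_rw [hsum]
      simp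
    rw [h1, hYi.charFun_map_fun_sum_eq_prod fun i => (hYm i).aemeasurable]
    simp only [Finset.prod_apply]
    have h2 : ∀ i, charFun (P.map (Y i)) 1
        = ∫ x, Complex.exp ((√(n : ℝ) : ℂ)⁻¹ * ((√(g n) : ℂ) * (⟪t', x⟫_ℝ : ℂ)) * Complex.I) ∂μ n := by
      intro i
      rw [charFun_apply_real, integral_map (hYm i).aemeasurable
        (Measurable.aestronglyMeasurable (by fun_prop)), ← hlaw n i,
        integral_map (hX n i).aemeasurable (Measurable.aestronglyMeasurable (by fun_prop))]
      simp [Y]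
    simp_rw [h2]
    simp
  · filter_upwards [hμ.axial] with n hax using hax.isProbabilityMeasure
  · filter_upwards [hμ.axial] with n hax
    have := hax.isProbabilityMeasure
    refine MemLp.of_bound (hh n).aestronglyMeasurable (√(g n) * ‖t'‖) ?_
    filter_upwards [hax.norm_eq_one] with x hx
    have := abs_real_inner_le_norm t' x
    rw [hx, mul_one] at this
    rw [norm_mul, Real.norm_of_nonneg (Real.sqrt_nonneg _), Real.norm_eq_abs]
    gcongr
  · filter_upwards [hμ.axial] with n hax
    rw [integral_const_mul, hax.integral_inner_eq_zero ht0, mul_zero]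
  · have h := (hμ.tendsto_mul_integral_one_sub_inner_sq hθ).const_mul (‖t'‖ ^ 2 / ((p : ℝ) - 1))
    rw [div_mul_cancel₀ _ (by linarith)] at h
    refine h.congr' ?_
    filter_upwards [hμ.axial, hμ.scale.eventually_ge_atTop 0] with n hax hg
    simp_rw [mul_pow, Real.sq_sqrt hg]
    rw [integral_const_mul, hax.integral_inner_sq hθ (by simpa using hp) ht0,
      finrank_euclideanSpace, Fintype.card_fin]
    ring
  · filter_upwards [hμ.axial, hC, hμ.scale.eventually_ge_atTop 0] with n hax hCn hg
    have := hax.isProbabilityMeasure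
    refine le_trans ?_ (mul_le_mul_of_nonneg_left hCn (by positivity))
    rw [← integral_const_mul]
    -- Cauchy–Schwarz on tangential parts: the squared tangential length of a unit vector is `1 -
    -- ⟪x, θ⟫²`.
    have hb : ∀ x : EuclideanSpace ℝ (Fin p), ‖x‖ = 1 →
        (√(g n) * ⟪t', x⟫_ℝ) ^ 4 ≤ ‖t'‖ ^ 4 * (g n * (1 - ⟪x, θ⟫_ℝ ^ 2)) ^ 2 := by
      intro x hx
      have h1 : ⟪t', x⟫_ℝ = ⟪t', x - ⟪x, θ⟫_ℝ • θ⟫_ℝ := by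
        rw [inner_sub_right, real_inner_smul_right, ht0, mul_zero, sub_zero]
      have h2 := abs_real_inner_le_norm t' (x - ⟪x, θ⟫_ℝ • θ)
      have h3 := norm_sub_inner_smul_sq hθ x
      rw [hx, one_pow] at h3
      rw [← h1] at h2
      rw [← h3]
      calc (√(g n) * ⟪t', x⟫_ℝ) ^ 4 = g n ^ 2 * |⟪t', x⟫_ℝ| ^ 4 := by
            rw [mul_pow, (show Even 4 by decide).pow_abs, show √(g n) ^ 4 = (√(g n) ^ 2) ^ 2 by ring,
              Real.sq_sqrt hg]
        _ ≤ g n ^ 2 * (‖t'‖ * ‖x - ⟪x, θ⟫_ℝ • θ‖) ^ 4 := by gcongr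
        _ = _ := by ring
    have hint : Integrable (fun x => ‖t'‖ ^ 4 * (g n * (1 - ⟪x, θ⟫_ℝ ^ 2)) ^ 2) (μ n) :=
      integrable_axial hθ hax (F := fun u => ‖t'‖ ^ 4 * (g n * (1 - u ^ 2)) ^ 2) (by fun_prop)
    refine integral_mono_ae (hint.mono' ((hh n).pow_const 4).aestronglyMeasurable ?_) hint ?_
    · filter_upwards [hax.norm_eq_one] with x hx
      rw [Real.norm_of_nonneg (by positivity)]
      exact hb x hx
    · filter_upwards [hax.norm_eq_one] with x hx using hb x hx

end IsConcentrating

end AxialArray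

/-! ### Consistency and asymptotic normality of the studentized mean. -/

namespace IsConcentrating

variable {p : ℕ} {θ : EuclideanSpace ℝ (Fin p)}
  {μ : ℕ → Measure (EuclideanSpace ℝ (Fin p))} {g : ℕ → ℝ}
  {Ω : Type*} {mΩ : MeasurableSpace Ω} {P : Measure Ω} [IsProbabilityMeasure P]
  {X : ∀ n, Fin n → Ω → EuclideanSpace ℝ (Fin p)}

omit [IsProbabilityMeasure P] in
theorem eventually_ae_norm_eq_one (hμ : IsConcentrating θ μ g) (hX : ∀ n i, Measurable (X n i))
    (hlaw : ∀ n i, P.map (X n i) = μ n) :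
    ∀ᶠ n in atTop, ∀ᵐ ω ∂P, ∀ i, ‖X n i ω‖ = 1 := by
  filter_upwards [hμ.axial] with n hax
  refine ae_all_iff.2 fun i => ae_of_ae_map (p := fun x => ‖x‖ = 1) (hX n i).aemeasurable ?_
  rw [hlaw n i]
  exact hax.norm_eq_one

theorem tendstoInMeasure_inner_sampleMean (hθ : ‖θ‖ = 1)
    (hμ : IsConcentrating θ μ g) (hX : ∀ n i, Measurable (X n i))
    (hind : ∀ n, iIndepFun (X n) P) (hlaw : ∀ n i, P.map (X n i) = μ n) :
    TendstoInMeasure P (fun n ω => ⟪sampleMean (fun i => X n i ω), θ⟫_ℝ) atTop (fun _ => 1) := by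
  have e : (fun n ω => ⟪sampleMean (fun i => X n i ω), θ⟫_ℝ)
      = fun (n : ℕ) ω => (n : ℝ)⁻¹ * ∑ i, ⟪X n i ω, θ⟫_ℝ := by
    ext n ω
    rw [sampleMean, real_inner_smul_left, sum_inner]
  have hb : ∀ x : EuclideanSpace ℝ (Fin p), ‖x‖ = 1 → |⟪x, θ⟫_ℝ| ≤ 1 := fun x hx => by
    have := abs_real_inner_le_norm x θ
    rwa [hx, hθ, mul_one] at this
  rw [e]
  refine tendstoInMeasure_row_mean (C := 1) hX hind hlaw (h := fun _ x => ⟪x, θ⟫_ℝ)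
    (fun _ => by fun_prop) ?_ ?_ ?_
  · filter_upwards [hμ.axial] with n hax
    have := hax.isProbabilityMeasure
    refine MemLp.of_bound (Measurable.aestronglyMeasurable (by fun_prop)) 1 ?_
    filter_upwards [hax.norm_eq_one] with x hx using hb x hx
  · have h := (hμ.tendsto_integral_one_sub_inner).const_sub 1
    rw [sub_zero] at h
    refine h.congr' ?_
    filter_upwards [hμ.axial] with n hax
    have := hax.isProbabilityMeasure
    rw [integral_sub (integrable_const _) (integrable_axial hθ hax (F := fun u => u) continuous_id)]
    simp
  · filter_upwards [hμ.axial] with n hax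
    have := hax.isProbabilityMeasure
    have h1 : ∫ _ : EuclideanSpace ℝ (Fin p), (1 : ℝ) ∂μ n = 1 := by simp
    rw [← h1]
    refine integral_mono_ae (integrable_axial hθ hax (F := fun u => u ^ 2) (by fun_prop))
      (integrable_const _) ?_
    filter_upwards [hax.norm_eq_one] with x hx
    exact (sq_le_one_iff_abs_le_one _).2 (hb x hx)

theorem tendstoInMeasure_row_mean_one_sub_inner_sq (hθ : ‖θ‖ = 1)
    (hμ : IsConcentrating θ μ g) (hX : ∀ n i, Measurable (X n i))
    (hind : ∀ n, iIndepFun (X n) P) (hlaw : ∀ n i, P.map (X n i) = μ n) :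
    TendstoInMeasure P (fun (n : ℕ) ω => (n : ℝ)⁻¹ * ∑ i, g n * (1 - ⟪X n i ω, θ⟫_ℝ ^ 2)) atTop
      (fun _ => (p : ℝ) - 1) := by
  obtain ⟨C, hC⟩ := hμ.eventually_integral_sq_le hθ
  refine tendstoInMeasure_row_mean (C := C) hX hind hlaw
    (h := fun n x => g n * (1 - ⟪x, θ⟫_ℝ ^ 2)) (fun _ => by fun_prop) ?_ ?_ hC
  · filter_upwards [hμ.axial] with n hax
    refine (memLp_two_iff_integrable_sq (Measurable.aestronglyMeasurable (by fun_prop))).2 ?_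
    exact integrable_axial hθ hax (F := fun u => (g n * (1 - u ^ 2)) ^ 2) (by fun_prop)
  · refine (hμ.tendsto_mul_integral_one_sub_inner_sq hθ).congr fun n => ?_
    rw [integral_const_mul]

/-- The quantity is `n^(-1/2)` times the norm of a sequence that converges in distribution. -/
theorem tendstoInMeasure_sqrt_mul_norm_tangential (hp : 2 ≤ p) (hθ : ‖θ‖ = 1)
    (hμ : IsConcentrating θ μ g) (hX : ∀ n i, Measurable (X n i))
    (hind : ∀ n, iIndepFun (X n) P) (hlaw : ∀ n i, P.map (X n i) = μ n) :
    TendstoInMeasure P (fun n ω => √(g n) * ‖sampleMean (fun i => X n i ω) -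
        ⟪sampleMean (fun i => X n i ω), θ⟫_ℝ • θ‖) atTop (fun _ => 0) := by
  have hS := hμ.tendstoInDistribution_tangential hp hθ hX hind hlaw
  have hr : Tendsto (fun n : ℕ => (√(n : ℝ))⁻¹) atTop (𝓝 0) :=
    tendsto_inv_atTop_zero.comp (Real.tendsto_sqrt_atTop.comp tendsto_natCast_atTop_atTop)
  have h1 := hS.continuous_comp_prodMk_of_tendstoInMeasure_const
    (g := fun z : EuclideanSpace ℝ (Fin p) × ℝ => z.2 * ‖z.1‖) (by fun_prop)
    (tendstoInMeasure_const_of_tendsto (P := P) hr) fun n => aemeasurable_const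
  simp only [zero_mul] at h1
  refine (h1.tendstoInMeasure_const).congr' ?_ (ae_eq_refl _)
  filter_upwards [eventually_gt_atTop 0] with n hn0
  refine Eventually.of_forall fun ω => ?_
  have hn : (0 : ℝ) < n := by exact_mod_cast hn0
  have h0 : √(n : ℝ) ≠ 0 := (Real.sqrt_pos.2 hn).ne'
  simp only
  rw [norm_smul, Real.norm_of_nonneg (Real.sqrt_nonneg _), Real.sqrt_mul hn.le]
  field_simp

/-- Consistency of the rescaled estimator `g (1 - ê)`. -/
theorem tendstoInMeasure_mul_one_sub_eHatTwo (hp : 2 ≤ p) (hθ : ‖θ‖ = 1)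
    (hμ : IsConcentrating θ μ g) (hX : ∀ n i, Measurable (X n i))
    (hind : ∀ n, iIndepFun (X n) P) (hlaw : ∀ n i, P.map (X n i) = μ n) :
    TendstoInMeasure P (fun n ω => g n * (1 - eHatTwo fun i => X n i ω)) atTop
      (fun _ => (p : ℝ) - 1) := by
  have hu := hμ.tendstoInMeasure_inner_sampleMean hθ hX hind hlaw
  have hq := hμ.tendstoInMeasure_row_mean_one_sub_inner_sq hθ hX hind hlaw
  have hτ := hμ.tendstoInMeasure_sqrt_mul_norm_tangential hp hθ hX hind hlaw
  have hqτ := hq.prodMk_const hτ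
  have hY := hu.prodMk_const hqτ
  refine tendstoInMeasure_const_of_imp hY fun V hV => ?_
  obtain ⟨ε, hε, hεV⟩ := Metric.mem_nhds_iff.1 hV
  -- A majorant of the error in terms of the axial mean, the row average along `θ`, and `√g` times
  -- the tangential norm; it is continuous and zero at their limits `(1, p - 1, 0)`.
  let φ : ℝ × ℝ × ℝ → ℝ := fun y => |y.2.1 - ((p : ℝ) - 1)| +
    (y.2.2 / y.1 * (|y.2.1| + 1) + (y.2.2 / y.1) ^ 2)
  have hφ : ContinuousAt φ (1, (p : ℝ) - 1, 0) := by
    have : ContinuousAt (fun y : ℝ × ℝ × ℝ => y.2.2 / y.1) (1, (p : ℝ) - 1, 0) :=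
      ContinuousAt.div (by fun_prop) (by fun_prop) one_ne_zero
    fun_prop
  have hφ0 : φ (1, (p : ℝ) - 1, 0) < ε := by simpa [φ] using hε
  have h1 : Tendsto Prod.fst (𝓝 ((1, (p : ℝ) - 1, 0) : ℝ × ℝ × ℝ)) (𝓝 1) := continuousAt_fst
  have hU : ∀ᶠ y in 𝓝 ((1, (p : ℝ) - 1, 0) : ℝ × ℝ × ℝ), 0 < y.1 ∧ φ y < ε :=
    (h1.eventually_const_lt zero_lt_one).and (hφ.eventually_lt_const hφ0)
  refine ⟨{y | 0 < y.1 ∧ φ y < ε}, hU, ?_⟩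
  filter_upwards [hμ.eventually_ae_norm_eq_one hX hlaw, hμ.scale.eventually_ge_atTop 0,
    eventually_gt_atTop 0] with n hn hg hn0
  filter_upwards [hn] with ω hω hU
  obtain ⟨hu, hlt⟩ := hU
  refine hεV (Metric.mem_ball.2 (lt_of_le_of_lt ?_ hlt))
  have h1 := abs_mul_one_sub_eHatTwo_sub_le hn0 hθ hω hu hg
  have h2 := norm_sphericalMean_sub_le hθ hu
  simp only [φ]
  set u := ⟪sampleMean (fun i => X n i ω), θ⟫_ℝ
  set q := (n : ℝ)⁻¹ * ∑ i, g n * (1 - ⟪X n i ω, θ⟫_ℝ ^ 2)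
  set δ := ‖sphericalMean (fun i => X n i ω) - θ‖
  have h3 : √(g n) * δ ≤ √(g n) * ‖sampleMean (fun i => X n i ω) - u • θ‖ / u := by
    rw [mul_div_assoc]
    exact mul_le_mul_of_nonneg_left h2 (Real.sqrt_nonneg _)
  set τ := √(g n) * ‖sampleMean (fun i => X n i ω) - u • θ‖
  have h0 : 0 ≤ √(g n) * δ := by positivity
  rw [Real.dist_eq]
  calc |g n * (1 - eHatTwo fun i => X n i ω) - ((p : ℝ) - 1)|
      ≤ |q - ((p : ℝ) - 1)| + |g n * (1 - eHatTwo fun i => X n i ω) - q| := by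
        rw [add_comm]; exact abs_sub_le _ _ _
    _ ≤ |q - ((p : ℝ) - 1)| + (√(g n) * δ * (q + 1) + (√(g n) * δ) ^ 2) := by gcongr
    _ ≤ |q - ((p : ℝ) - 1)| + (√(g n) * δ * (|q| + 1) + (√(g n) * δ) ^ 2) := by
        gcongr
        exact le_abs_self q
    _ ≤ _ := by gcongr

/-- By Pythagoras: the axial part tends to 1, and the tangential part to 0 even after scaling by
`√g`. -/
theorem tendstoInMeasure_norm_sampleMean (hp : 2 ≤ p) (hθ : ‖θ‖ = 1)
    (hμ : IsConcentrating θ μ g) (hX : ∀ n i, Measurable (X n i))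
    (hind : ∀ n, iIndepFun (X n) P) (hlaw : ∀ n i, P.map (X n i) = μ n) :
    TendstoInMeasure P (fun n ω => ‖sampleMean (fun i => X n i ω)‖) atTop (fun _ => 1) := by
  have hr : Tendsto (fun n : ℕ => (√(g n))⁻¹) atTop (𝓝 0) :=
    tendsto_inv_atTop_zero.comp (Real.tendsto_sqrt_atTop.comp hμ.scale)
  have hu := hμ.tendstoInMeasure_inner_sampleMean hθ hX hind hlaw
  have hτ := hμ.tendstoInMeasure_sqrt_mul_norm_tangential hp hθ hX hind hlaw
  have hτr := hτ.prodMk_const (tendstoInMeasure_const_of_tendsto (P := P) hr)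
  have hY := hu.prodMk_const hτr
  have h := hY.comp_continuousAt (φ := fun y : ℝ × ℝ × ℝ => √(y.1 ^ 2 + (y.2.2 * y.2.1) ^ 2))
    (by fun_prop)
  simp only [mul_zero, one_pow, ne_eq, OfNat.ofNat_ne_zero, not_false_eq_true, zero_pow, add_zero,
    Real.sqrt_one] at h
  refine h.congr' ?_ (ae_eq_refl _)
  filter_upwards [hμ.scale.eventually_gt_atTop 0] with n hg
  refine Eventually.of_forall fun ω => ?_
  have h0 : √(g n) ≠ 0 := (Real.sqrt_pos.2 hg).ne'
  simp only
  rw [inv_mul_cancel_left₀ h0, ← norm_sampleMean_sq hθ, Real.sqrt_sq (norm_nonneg _)]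

/-- Asymptotic normality of the studentized spherical mean. -/
theorem tendstoInDistribution_studentized (hp : 2 ≤ p) (hθ : ‖θ‖ = 1)
    (hμ : IsConcentrating θ μ g) (hX : ∀ n i, Measurable (X n i))
    (hind : ∀ n, iIndepFun (X n) P) (hlaw : ∀ n i, P.map (X n i) = μ n) :
    TendstoInDistribution
      (fun (n : ℕ) ω => (√(n * ((p : ℝ) - 1)) / √(1 - eHatTwo fun i => X n i ω)) •
            (sphericalMean (fun i => X n i ω) - θ)) atTop id (fun _ => P)
      (multivariateGaussian 0 (1 - Matrix.vecMulVec θ.ofLp θ.ofLp)) := by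
  have hp' : (2 : ℝ) ≤ p := by exact_mod_cast hp
  have hp1 : (0 : ℝ) < (p : ℝ) - 1 := by linarith
  have hS := hμ.tendstoInDistribution_tangential hp hθ hX hind hlaw
  have hu := hμ.tendstoInMeasure_inner_sampleMean hθ hX hind hlaw
  have hG := hμ.tendstoInMeasure_mul_one_sub_eHatTwo hp hθ hX hind hlaw
  have hN := hμ.tendstoInMeasure_norm_sampleMean hp hθ hX hind hlaw
  have hw : Tendsto (fun n : ℕ => (√(n * g n))⁻¹) atTop (𝓝 0) :=
    tendsto_inv_atTop_zero.comp (Real.tendsto_sqrt_atTop.comp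
      (tendsto_natCast_atTop_atTop.atTop_mul_atTop₀ hμ.scale))
  have mm : ∀ n, Measurable fun ω => sampleMean (fun i => X n i ω) := fun n =>
    measurable_sampleMean.comp (by fun_prop)
  have ms : ∀ n, Measurable fun ω => sphericalMean (fun i => X n i ω) := fun n =>
    measurable_sphericalMean.comp (by fun_prop)
  have me : ∀ n, Measurable fun ω => eHatTwo (fun i => X n i ω) := fun n =>
    measurable_eHatTwo.comp (by fun_prop)
  let A : ℕ → Ω → ℝ := fun n ω => √((p : ℝ) - 1) /
    (√(g n * (1 - eHatTwo fun i => X n i ω)) * ‖sampleMean (fun i => X n i ω)‖)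
  let D : ℕ → Ω → ℝ := fun n ω => -(√((p : ℝ) - 1) / √(g n * (1 - eHatTwo fun i => X n i ω)) /
    (‖sampleMean (fun i => X n i ω)‖ * (‖sampleMean (fun i => X n i ω)‖ +
      ⟪sampleMean (fun i => X n i ω), θ⟫_ℝ)) * (√(n * g n))⁻¹)
  let S : ℕ → Ω → EuclideanSpace ℝ (Fin p) := fun n ω => √(n * g n) •
    (sampleMean (fun i => X n i ω) - ⟪sampleMean (fun i => X n i ω), θ⟫_ℝ • θ)
  let Z : ℕ → Ω → EuclideanSpace ℝ (Fin p) := fun n ω =>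
    (√(n * ((p : ℝ) - 1)) / √(1 - eHatTwo fun i => X n i ω)) •
      (sphericalMean (fun i => X n i ω) - θ)
  -- The expansion holds only where the axial mean and `1 - eHatTwo` are positive. `R` makes it an
  -- identity everywhere and vanishes with probability tending to one.
  let R : ℕ → Ω → EuclideanSpace ℝ (Fin p) := fun n ω =>
    Z n ω - (A n ω • S n ω + (D n ω * ‖S n ω‖ ^ 2) • θ)
  have hs0 : √((p : ℝ) - 1) ≠ 0 := (Real.sqrt_pos.2 hp1).ne'
  have hA : TendstoInMeasure P A atTop (fun _ => 1) := by
    have h := (hG.prodMk_const hN).comp_continuousAt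
      (φ := fun y : ℝ × ℝ => √((p : ℝ) - 1) / (√y.1 * y.2))
      (ContinuousAt.div (by fun_prop) (by fun_prop) (by simpa using hs0))
    simpa [hs0] using h
  have hD : TendstoInMeasure P D atTop (fun _ => 0) := by
    have hGN := hG.prodMk_const hN
    have huw := hu.prodMk_const (tendstoInMeasure_const_of_tendsto (P := P) hw)
    have h := (hGN.prodMk_const huw).comp_continuousAt
      (φ := fun y : (ℝ × ℝ) × (ℝ × ℝ) =>
        -(√((p : ℝ) - 1) / √y.1.1 / (y.1.2 * (y.1.2 + y.2.1)) * y.2.2))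
      (ContinuousAt.neg (ContinuousAt.mul (ContinuousAt.div (ContinuousAt.div (by fun_prop)
        (by fun_prop) hs0) (by fun_prop) (by norm_num)) (by fun_prop)))
    simp only [mul_zero, neg_zero] at h
    exact h
  have hR : TendstoInMeasure P R atTop (fun _ => 0) := by
    have h1 : Tendsto Prod.fst (𝓝 ((1, (p : ℝ) - 1) : ℝ × ℝ)) (𝓝 1) := continuousAt_fst
    have h2 : Tendsto Prod.snd (𝓝 ((1, (p : ℝ) - 1) : ℝ × ℝ)) (𝓝 ((p : ℝ) - 1)) :=
      continuousAt_snd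
    have hU : ∀ᶠ y in 𝓝 ((1, (p : ℝ) - 1) : ℝ × ℝ), 0 < y.1 ∧ 0 < y.2 :=
      (h1.eventually_const_lt zero_lt_one).and (h2.eventually_const_lt hp1)
    have huG := hu.prodMk_const hG
    refine tendstoInMeasure_const_of_imp huG fun V hV =>
      ⟨{y | 0 < y.1 ∧ 0 < y.2}, hU, ?_⟩
    filter_upwards [hμ.scale.eventually_gt_atTop 0, eventually_gt_atTop 0] with n hg hn
    refine Eventually.of_forall fun ω hU => ?_
    have he : 0 < 1 - eHatTwo fun i => X n i ω := pos_of_mul_pos_right hU.2 hg.le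
    have : R n ω = 0 := sub_eq_zero.2 (studentized_sphericalMean_eq hθ hU.1 hn hg he rfl)
    rw [this]
    exact mem_of_mem_nhds hV
  have mA : ∀ n, Measurable (A n) := fun n => by have := mm n; have := me n; fun_prop
  have mD : ∀ n, Measurable (D n) := fun n => by have := mm n; have := me n; fun_prop
  have mS : ∀ n, Measurable (S n) := fun n => by have := mm n; fun_prop
  have mZ : ∀ n, Measurable (Z n) := fun n => by have := ms n; have := me n; fun_prop
  have mR : ∀ n, Measurable (R n) := fun n => by
    have := mA n; have := mD n; have := mS n; have := mZ n; fun_prop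
  have hDR := hD.prodMk_const hR
  have hADR := hA.prodMk_const hDR
  have key := hS.continuous_comp_prodMk_of_tendstoInMeasure_const
    (g := fun z : EuclideanSpace ℝ (Fin p) × (ℝ × ℝ × EuclideanSpace ℝ (Fin p)) =>
      z.2.1 • z.1 + (z.2.2.1 * ‖z.1‖ ^ 2) • θ + z.2.2.2) (by fun_prop)
    hADR
    fun n => ((mA n).prodMk ((mD n).prodMk (mR n))).aemeasurable
  refine key.congr (fun n => Eventually.of_forall fun ω => ?_) (Eventually.of_forall fun ω => ?_)
  · change A n ω • S n ω + (D n ω * ‖S n ω‖ ^ 2) • θ + R n ω = Z n ω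
    simp only [R]
    abel
  · simp

end IsConcentrating

/-! ### Convergence in distribution under changes of law, space and sequence. -/

section Transfer

theorem MeasureTheory.TendstoInDistribution.congr_law {Ω ι Ω₁ Ω₂ F : Type*}
    {mΩ : MeasurableSpace Ω} {P : Measure Ω} [IsProbabilityMeasure P]
    {m₁ : MeasurableSpace Ω₁} {m₂ : MeasurableSpace Ω₂} {P₁ : Measure Ω₁} [IsProbabilityMeasure P₁]
    {P₂ : Measure Ω₂} [IsProbabilityMeasure P₂] [TopologicalSpace F] [MeasurableSpace F]
    [OpensMeasurableSpace F] {l : Filter ι} {Y : ι → Ω → F} {Z₁ : Ω₁ → F} {Z₂ : Ω₂ → F}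
    (h : TendstoInDistribution Y l Z₁ (fun _ => P) P₁) (hZ₂ : AEMeasurable Z₂ P₂)
    (he : P₁.map Z₁ = P₂.map Z₂) : TendstoInDistribution Y l Z₂ (fun _ => P) P₂ where
  forall_aemeasurable := h.forall_aemeasurable
  aemeasurable_limit := hZ₂
  tendsto := by
    have h1 := h.tendsto
    have e : (⟨P₁.map Z₁, Measure.isProbabilityMeasure_map h.aemeasurable_limit⟩ :
        ProbabilityMeasure F) = ⟨P₂.map Z₂, Measure.isProbabilityMeasure_map hZ₂⟩ :=
      Subtype.ext he
    rwa [e] at h1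

/-- Convergence in distribution only depends on the laws, so that it may be proved on the product
space. -/
theorem MeasureTheory.TendstoInDistribution.of_infinitePi {ι Ω' F : Type*} {Ω G : ι → Type*}
    {mΩ : ∀ i, MeasurableSpace (Ω i)} {mG : ∀ i, MeasurableSpace (G i)}
    {P : ∀ i, Measure (Ω i)} [∀ i, IsProbabilityMeasure (P i)]
    {ρ : ∀ i, Measure (G i)} [∀ i, IsProbabilityMeasure (ρ i)]
    {mΩ' : MeasurableSpace Ω'} {P' : Measure Ω'} [IsProbabilityMeasure P']
    [TopologicalSpace F] [MeasurableSpace F] [OpensMeasurableSpace F] {l : Filter ι}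
    {T : ∀ i, G i → F} (hT : ∀ i, Measurable (T i)) {V : ∀ i, Ω i → G i}
    (hV : ∀ i, HasLaw (V i) (ρ i) (P i)) {Z : Ω' → F}
    (h : TendstoInDistribution (fun i ω => T i (ω i)) l Z (fun _ => Measure.infinitePi ρ) P') :
    TendstoInDistribution (fun i ω => T i (V i ω)) l Z P P' where
  forall_aemeasurable i := (hT i).comp_aemeasurable (hV i).aemeasurable
  aemeasurable_limit := h.aemeasurable_limit
  tendsto := by
    refine h.tendsto.congr fun i => Subtype.ext ?_
    change (Measure.infinitePi ρ).map (T i ∘ fun ω => ω i) = (P i).map (T i ∘ V i)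
    rw [← Measure.map_map (hT i) (measurable_pi_apply i), Measure.infinitePi_map_eval,
      ← AEMeasurable.map_map_of_aemeasurable (hT i).aemeasurable (hV i).aemeasurable,
      (hV i).map_eq]

end Transfer

/-- A sequence that agrees with a sequence converging in distribution, with probability tending
to one, has the same limit. -/
theorem MeasureTheory.TendstoInDistribution.of_eq_of_tendstoInMeasure {Ω Ω' F H : Type*}
    {mΩ : MeasurableSpace Ω} {P : Measure Ω} [IsProbabilityMeasure P]
    {mΩ' : MeasurableSpace Ω'} {P' : Measure Ω'} [IsProbabilityMeasure P']
    [SeminormedAddCommGroup F] [SecondCountableTopology F] [MeasurableSpace F] [BorelSpace F]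
    [PseudoMetricSpace H] {S T : ℕ → Ω → F} {Z : Ω' → F} {Y : ℕ → Ω → H} {c : H}
    (hS : TendstoInDistribution S atTop Z (fun _ => P) P') (hT : ∀ n, Measurable (T n))
    (hY : TendstoInMeasure P Y atTop (fun _ => c)) {U : Set H} (hU : U ∈ 𝓝 c)
    (h : ∀ᶠ n in atTop, ∀ ω, Y n ω ∈ U → T n ω = S n ω) :
    TendstoInDistribution T atTop Z (fun _ => P) P' := by
  refine tendstoInDistribution_of_tendstoInMeasure_sub T Z hS ?_ fun n => (hT n).aemeasurable
  refine tendstoInMeasure_const_of_imp (d := 0) hY fun V hV => ⟨U, hU, ?_⟩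
  filter_upwards [h] with n hn
  refine Eventually.of_forall fun ω hω => ?_
  rw [Pi.sub_apply, Pi.sub_apply, hn ω hω, sub_self]
  exact mem_of_mem_nhds hV

/-- Portmanteau: the boundary of the half-line is a single point, which the limit law does not
charge. -/
theorem tendsto_measure_le_chiSquaredUpperQuantile {Ω : Type*} {mΩ : MeasurableSpace Ω}
    {P : Measure Ω} [IsProbabilityMeasure P] {T : ℕ → Ω → ℝ} {k : ℕ} (hk : k ≠ 0)
    (hT : ∀ n, Measurable (T n))
    (h : TendstoInDistribution T atTop id (fun _ => P) (chiSquared k)) {α : ℝ} (h0 : 0 < α)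
    (h1 : α < 1) :
    Tendsto (fun n => P {ω | T n ω ≤ chiSquaredUpperQuantile k α}) atTop
      (𝓝 (ENNReal.ofReal (1 - α))) := by
  set q := chiSquaredUpperQuantile k α with hq
  have hfr : (chiSquared k).map id (frontier (Set.Iic q)) = 0 := by
    rw [Measure.map_id, frontier_Iic, chiSquared_singleton hk]
  have key := ProbabilityMeasure.tendsto_measure_of_null_frontier_of_tendsto' h.tendsto hfr
  simp only [ProbabilityMeasure.coe_mk, Measure.map_id] at key
  rw [← cdf_chiSquaredUpperQuantile hk h0 h1, ← hq, ofReal_cdf]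
  refine key.congr fun n => ?_
  rw [Measure.map_apply (hT n) measurableSet_Iic]
  rfl

/-! ### Chi-square limits and coverage of the cap. -/

namespace IsConcentrating

variable {p : ℕ} {θ : EuclideanSpace ℝ (Fin p)}
  {μ : ℕ → Measure (EuclideanSpace ℝ (Fin p))} {g : ℕ → ℝ}
  {Ω : Type*} {mΩ : MeasurableSpace Ω} {P : Measure Ω} [IsProbabilityMeasure P]
  {X : ∀ n, Fin n → Ω → EuclideanSpace ℝ (Fin p)}

/-- Continuous mapping for the quadratic forms `‖z‖² - c ⟪z, θ⟫²` of the studentized mean. -/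
theorem tendstoInDistribution_of_eq_quadratic (hp : 2 ≤ p) (hθ : ‖θ‖ = 1)
    (hμ : IsConcentrating θ μ g) (hX : ∀ n i, Measurable (X n i))
    (hind : ∀ n, iIndepFun (X n) P) (hlaw : ∀ n i, P.map (X n i) = μ n) (c : ℝ)
    {T : ℕ → Ω → ℝ} (hT : ∀ n, Measurable (T n))
    (h : ∀ n ω, 0 < ⟪sampleMean (fun i => X n i ω), θ⟫_ℝ → 0 < 1 - eHatTwo (fun i => X n i ω) →
      T n ω = n * ((p : ℝ) - 1) / (1 - eHatTwo fun i => X n i ω) *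
        (‖sphericalMean (fun i => X n i ω) - θ‖ ^ 2
          - c * ⟪sphericalMean (fun i => X n i ω) - θ, θ⟫_ℝ ^ 2)) :
    TendstoInDistribution T atTop id (fun _ => P) (chiSquared (p - 1)) := by
  have hp' : (2 : ℝ) ≤ p := by exact_mod_cast hp
  have hp1 : (0 : ℝ) < (p : ℝ) - 1 := by linarith
  have hZ := hμ.tendstoInDistribution_studentized hp hθ hX hind hlaw
  have hQ := (hZ.continuous_comp (g := fun z : EuclideanSpace ℝ (Fin p) =>
    ‖z‖ ^ 2 - c * ⟪z, θ⟫_ℝ ^ 2) (by fun_prop)).congr_law (Z₂ := id) (P₂ := chiSquared (p - 1))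
    aemeasurable_id (by
      rw [Measure.map_id]
      exact map_tangentGaussian_eq_chiSquared hθ c)
  have hu := hμ.tendstoInMeasure_inner_sampleMean hθ hX hind hlaw
  have hG := hμ.tendstoInMeasure_mul_one_sub_eHatTwo hp hθ hX hind hlaw
  have huG := hu.prodMk_const hG
  have h1 : Tendsto Prod.fst (𝓝 ((1, (p : ℝ) - 1) : ℝ × ℝ)) (𝓝 1) := continuousAt_fst
  have h2 : Tendsto Prod.snd (𝓝 ((1, (p : ℝ) - 1) : ℝ × ℝ)) (𝓝 ((p : ℝ) - 1)) :=
    continuousAt_snd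
  have hU : ∀ᶠ y in 𝓝 ((1, (p : ℝ) - 1) : ℝ × ℝ), 0 < y.1 ∧ 0 < y.2 :=
    (h1.eventually_const_lt zero_lt_one).and (h2.eventually_const_lt hp1)
  refine hQ.of_eq_of_tendstoInMeasure hT huG hU ?_
  filter_upwards [hμ.scale.eventually_gt_atTop 0] with n hg ω hω
  have he : 0 < 1 - eHatTwo fun i => X n i ω := pos_of_mul_pos_right hω.2 hg.le
  have hn : (0 : ℝ) ≤ n * ((p : ℝ) - 1) := by positivity
  rw [h n ω hω.1 he]
  simp only [Function.comp_apply]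
  rw [norm_smul, real_inner_smul_left, mul_pow, mul_pow, Real.norm_eq_abs, sq_abs, div_pow,
    Real.sq_sqrt hn, Real.sq_sqrt he.le]
  ring

/-- With `v = ⟪θ, sphericalMean⟫`, the identity `1 - v² = 2(1-v) - (v-1)²` is the quadratic form
with `c = 1`. -/
theorem tendstoInDistribution_one_sub_inner_sq (hp : 2 ≤ p) (hθ : ‖θ‖ = 1)
    (hμ : IsConcentrating θ μ g) (hX : ∀ n i, Measurable (X n i))
    (hind : ∀ n, iIndepFun (X n) P) (hlaw : ∀ n i, P.map (X n i) = μ n) :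
    TendstoInDistribution (fun (n : ℕ) ω =>
        n * ((p : ℝ) - 1) * (1 - ⟪θ, sphericalMean fun i => X n i ω⟫_ℝ ^ 2)
          / (1 - eHatTwo fun i => X n i ω)) atTop id (fun _ => P) (chiSquared (p - 1)) := by
  refine hμ.tendstoInDistribution_of_eq_quadratic hp hθ hX hind hlaw 1 (fun n => ?_)
    fun n ω hu he => ?_
  · have ms : Measurable fun ω => sphericalMean (fun i => X n i ω) :=
      measurable_sphericalMean.comp (by fun_prop)
    have me : Measurable fun ω => eHatTwo (fun i => X n i ω) := measurable_eHatTwo.comp (by fun_prop)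
    fun_prop
  · rw [norm_sphericalMean_sub_sq hθ hu, inner_sub_left, real_inner_self_eq_norm_sq, hθ,
      real_inner_comm]
    ring

/-- For unit vectors `2(1-v)` is the squared distance, the quadratic form with `c = 0`. -/
theorem tendstoInDistribution_one_sub_inner (hp : 2 ≤ p) (hθ : ‖θ‖ = 1)
    (hμ : IsConcentrating θ μ g) (hX : ∀ n i, Measurable (X n i))
    (hind : ∀ n, iIndepFun (X n) P) (hlaw : ∀ n i, P.map (X n i) = μ n) :
    TendstoInDistribution (fun (n : ℕ) ω =>
        2 * n * ((p : ℝ) - 1) * (1 - ⟪θ, sphericalMean fun i => X n i ω⟫_ℝ)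
          / (1 - eHatTwo fun i => X n i ω)) atTop id (fun _ => P) (chiSquared (p - 1)) := by
  refine hμ.tendstoInDistribution_of_eq_quadratic hp hθ hX hind hlaw 0 (fun n => ?_)
    fun n ω hu he => ?_
  · have ms : Measurable fun ω => sphericalMean (fun i => X n i ω) :=
      measurable_sphericalMean.comp (by fun_prop)
    have me : Measurable fun ω => eHatTwo (fun i => X n i ω) := measurable_eHatTwo.comp (by fun_prop)
    fun_prop
  · rw [norm_sphericalMean_sub_sq hθ hu]
    ring

/-- Asymptotic coverage of the feasible cap. -/
theorem tendsto_measure_mem_feasibleCap (hp : 2 ≤ p) (hθ : ‖θ‖ = 1)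
    (hμ : IsConcentrating θ μ g) (hX : ∀ n i, Measurable (X n i))
    (hind : ∀ n, iIndepFun (X n) P) (hlaw : ∀ n i, P.map (X n i) = μ n) {α : ℝ} (h0 : 0 < α)
    (h1 : α < 1) :
    Tendsto (fun n : ℕ => P {ω | θ ∈ feasibleCap α fun i => X n i ω}) atTop
      (𝓝 (ENNReal.ofReal (1 - α))) := by
  have hp' : (2 : ℝ) ≤ p := by exact_mod_cast hp
  have hp1 : (0 : ℝ) < (p : ℝ) - 1 := by linarith
  have hB := tendsto_measure_le_chiSquaredUpperQuantile (by omega)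
    (fun n => by
      have ms : Measurable fun ω => sphericalMean (fun i => X n i ω) :=
        measurable_sphericalMean.comp (by fun_prop)
      have me : Measurable fun ω => eHatTwo (fun i => X n i ω) :=
        measurable_eHatTwo.comp (by fun_prop)
      fun_prop)
    (hμ.tendstoInDistribution_one_sub_inner hp hθ hX hind hlaw) h0 h1
  refine tendsto_measure_of_tendstoInMeasure
    (hμ.tendstoInMeasure_mul_one_sub_eHatTwo hp hθ hX hind hlaw) (Ioi_mem_nhds hp1) hB ?_
  filter_upwards [hμ.scale.eventually_gt_atTop 0, eventually_gt_atTop 0] with n hg hn0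
  refine Eventually.of_forall fun ω hω => ?_
  -- Positivity is what makes the cap inequality equivalent to the bound on the studentized
  -- statistic.
  have he : 0 < 1 - eHatTwo fun i => X n i ω := pos_of_mul_pos_right hω hg.le
  have hn : (0 : ℝ) < n := by exact_mod_cast hn0
  have hd : 0 < 2 * (n : ℝ) * ((p : ℝ) - 1) := by positivity
  simp only [feasibleCap, Set.mem_ofPred_eq, hθ, true_and]
  rw [div_le_iff₀ he, sub_le_comm, div_mul_eq_mul_div, le_div_iff₀ hd, mul_comm _ (2 * (n : ℝ) * _),
    mul_comm (chiSquaredUpperQuantile _ _)]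

end IsConcentrating

/-! ### Realization of all rows on one probability space. -/

section CanonicalModel

variable {E : Type*} [MeasurableSpace E] {Ω : ℕ → Type*} {mΩ : ∀ n, MeasurableSpace (Ω n)}
  {P : ∀ n, Measure (Ω n)} [∀ n, IsProbabilityMeasure (P n)] {X : ∀ n, Fin n → Ω n → E}
  {μ : ℕ → Measure E}

/-- The laws of the rows of a triangular array can be realized on one probability space. -/
theorem exists_row_laws (hlaw : ∀ n i, HasLaw (X n i) (μ n) (P n))
    (hindep : ∀ n, iIndepFun (X n) (P n)) :
    ∃ ρ : ∀ n, Measure (Fin n → E), ∃ _ : ∀ n, IsProbabilityMeasure (ρ n),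
      (∀ n, HasLaw (fun ω i => X n i ω) (ρ n) (P n)) ∧
      (∀ n, iIndepFun (fun i (ω : ∀ n, Fin n → E) => ω n i) (Measure.infinitePi ρ)) ∧
      ∀ n (i : Fin n), (Measure.infinitePi ρ).map (fun ω => ω n i) = μ n := by
  have hm : ∀ n, AEMeasurable (fun ω i => X n i ω) (P n) := fun n =>
    aemeasurable_pi_lambda _ fun i => (hlaw n i).aemeasurable
  let ρ : ∀ n, Measure (Fin n → E) := fun n => (P n).map fun ω i => X n i ω
  have hρ : ∀ n, IsProbabilityMeasure (ρ n) := fun n => Measure.isProbabilityMeasure_map (hm n)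
  have hμ : ∀ n (i : Fin n), (Measure.infinitePi ρ).map (fun ω => ω n i) = μ n := by
    intro n i
    have e : (fun ω : ∀ n, Fin n → E => ω n i) = (fun x : Fin n → E => x i) ∘ fun ω => ω n := rfl
    rw [e, ← Measure.map_map (measurable_pi_apply i) (measurable_pi_apply n),
      Measure.infinitePi_map_eval, AEMeasurable.map_map_of_aemeasurable
        (measurable_pi_apply i).aemeasurable (hm n), ← (hlaw n i).map_eq]
    rfl
  refine ⟨ρ, hρ, fun n => ⟨hm n, rfl⟩, fun n => ?_, hμ⟩
  rw [iIndepFun_iff_map_fun_eq_pi_map fun i => Measurable.aemeasurable (by fun_prop)]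
  simp_rw [hμ]
  have h := (iIndepFun_iff_map_fun_eq_pi_map fun i => (hlaw n i).aemeasurable).1 (hindep n)
  simp_rw [fun i => (hlaw n i).map_eq] at h
  rw [← h]
  exact Measure.infinitePi_map_eval ρ n

end CanonicalModel

theorem theorem5 (p : ℕ) (hp : 2 ≤ p) (θ : EuclideanSpace ℝ (Fin p)) (hθ : ‖θ‖ = 1)
    (f : ℝ → ℝ) (hf : IsAngularFunction f)
    (κ : ℕ → ℝ) (hκ_pos : ∀ n, 0 < κ n) (hκ : Tendsto κ atTop atTop)
    {Ω : ℕ → Type*} [∀ n, MeasurableSpace (Ω n)]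
    (P : ∀ n, Measure (Ω n)) [∀ n, IsProbabilityMeasure (P n)]
    (X : ∀ n, Fin n → Ω n → EuclideanSpace ℝ (Fin p))
    (hlaw : ∀ n i, HasLaw (X n i) (rotLaw θ (κ n) f) (P n))
    (hindep : ∀ n, iIndepFun (X n) (P n)) :
    TendstoInDistribution
        (fun (n : ℕ) ω =>
          (Real.sqrt (n * ((p : ℝ) - 1)) / Real.sqrt (1 - eHatTwo fun i => X n i ω)) •
            (sphericalMean (fun i => X n i ω) - θ))
        atTop id P
        (multivariateGaussian 0 (1 - Matrix.vecMulVec θ.ofLp θ.ofLp)) ∧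
      TendstoInDistribution
        (fun (n : ℕ) ω =>
          n * ((p : ℝ) - 1) * (1 - ⟪θ, sphericalMean fun i => X n i ω⟫_ℝ ^ 2)
            / (1 - eHatTwo fun i => X n i ω))
        atTop id P (chiSquared (p - 1)) ∧
      TendstoInDistribution
        (fun (n : ℕ) ω =>
          2 * n * ((p : ℝ) - 1) * (1 - ⟪θ, sphericalMean fun i => X n i ω⟫_ℝ)
            / (1 - eHatTwo fun i => X n i ω))
        atTop id P (chiSquared (p - 1)) ∧
      ∀ α : ℝ, 0 < α → α < 1 →
        Tendsto (fun n : ℕ => P n {ω | θ ∈ feasibleCap α fun i => X n i ω}) atTop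
          (𝓝 (ENNReal.ofReal (1 - α))) := by
  obtain ⟨ρ, hρ, hV, hind, hmap⟩ := exists_row_laws hlaw hindep
  have hX : ∀ n (i : Fin n), Measurable
      fun ω : ∀ n, Fin n → EuclideanSpace ℝ (Fin p) => ω n i := fun n i => by fun_prop
  -- Being the law of an observation, `rotLaw` has mass one; row `0` is empty and gives no
  -- information, hence only eventually.
  have hprob : ∀ᶠ n in atTop, IsProbabilityMeasure (rotLaw θ (κ n) f) := by
    filter_upwards [eventually_gt_atTop 0] with n hn
    rw [← hmap n ⟨0, hn⟩]
    exact Measure.isProbabilityMeasure_map (hX n _).aemeasurable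
  have hμ := rotLaw_isConcentrating hp hθ hf hκ hprob
  have ms := fun n => measurable_sphericalMean (n := n) (p := p)
  have me := fun n => measurable_eHatTwo (n := n) (p := p)
  refine ⟨?_, ?_, ?_, fun α h0 h1 => ?_⟩
  · exact TendstoInDistribution.of_infinitePi (T := fun n (x : Fin n → EuclideanSpace ℝ (Fin p)) =>
        (√(n * ((p : ℝ) - 1)) / √(1 - eHatTwo x)) • (sphericalMean x - θ))
      (fun n => by have := ms n; have := me n; fun_prop) hV
      (hμ.tendstoInDistribution_studentized hp hθ hX hind hmap)
  · exact TendstoInDistribution.of_infinitePi (T := fun n (x : Fin n → EuclideanSpace ℝ (Fin p)) =>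
        n * ((p : ℝ) - 1) * (1 - ⟪θ, sphericalMean x⟫_ℝ ^ 2) / (1 - eHatTwo x))
      (fun n => by have := ms n; have := me n; fun_prop) hV
      (hμ.tendstoInDistribution_one_sub_inner_sq hp hθ hX hind hmap)
  · exact TendstoInDistribution.of_infinitePi (T := fun n (x : Fin n → EuclideanSpace ℝ (Fin p)) =>
        2 * n * ((p : ℝ) - 1) * (1 - ⟪θ, sphericalMean x⟫_ℝ) / (1 - eHatTwo x))
      (fun n => by have := ms n; have := me n; fun_prop) hV
      (hμ.tendstoInDistribution_one_sub_inner hp hθ hX hind hmap)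
  · refine (hμ.tendsto_measure_mem_feasibleCap hp hθ hX hind hmap h0 h1).congr fun n => ?_
    have hs : MeasurableSet {x : Fin n → EuclideanSpace ℝ (Fin p) | θ ∈ feasibleCap α x} := by
      have := ms n
      have := me n
      simp only [feasibleCap, Set.mem_ofPred_eq, hθ, true_and]
      exact measurableSet_le (by fun_prop) (by fun_prop)
    have hE : HasLaw (fun ω : ∀ n, Fin n → EuclideanSpace ℝ (Fin p) => ω n) (ρ n)
        (Measure.infinitePi ρ) :=
      ⟨(measurable_pi_apply n).aemeasurable, Measure.infinitePi_map_eval ρ n⟩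
    exact (hE.measure_eq hs).trans ((hV n).measure_eq hs).symm
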